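/- Let $k$ be a field of characteristic $0$, $\eta\in k$ with $\eta\neq 0$, and $0\neq\varphi\in k[z]$ of degree $l$. Put $\sigma(z)=z+\eta$ and $\bar\varphi=\sigma(\varphi)$, i.e. $\bar\varphi(z)=\varphi(z+\eta)$. Let $A=k[z;1,\eta,\varphi(z)]$ be the generalized Weyl algebra generated by $x,y,z$ subject to $xz=\sigma(z)x$, $yz=\sigma^{-1}(z)y$, $yx=\varphi(z)$, $xy=\bar\varphi(z)$. (Over any field $K$, and for $\mu\in K^\times$, $\epsilon\in K$, the algebra $K[z;\mu,\epsilon,\varphi]$ is defined in the same way with $\sigma(z)=\mu z+\epsilon$; it is called classical if $\mu=1$ and $\epsilon\ne0$.) Write $x_q=x^q$ for $q\ge 0$ and $x_q=y^{-q}$ for $q<0$, put $\|z^px_q\|=p+(l+1)|q|$, and let $\Gamma^nA$ be the span of all $z^px_q$ with $\|z^px_q\|\le n$. A Hochschild $2$-cochain is a $k$-bilinear map $F\colon A\times A\to A$; it preserves $\Gamma$ if $F(b,b')\in\Gamma^{\|b\|+\|b'\|}A$ for all $b,b'\in\{z^px_q\mid p\ge0,\ q\in\mathbb Z\}$; it is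 a cocycle if $uF(v,w)-F(uv,w)+F(u,vw)-F(u,v)w=0$ for all $u,v,w\in A$. Consider the conditions (a) $F(u,1)=F(1,v)=0$ for all $u,v\in A$; (b) $F(zu,v)=zF(u,v)$ for all $u,v\in A$, and $F(x^q,x^j)=F(y^q,y^j)=0$ for all $q,j\ge 0$. Let $f(1)=(x,-y,0,-\bar\varphi'(z))\in A^4$, viewed as a bimodule map $(A\otimes A)^4\to A$. A Hochschild cocycle $F_1$ is said to correspond to $f(1)$ if $F_1(u,v)=f(1)(\theta_2(u,v))$ for the following pairs $(u,v)$, where $p,q,i,j\ge0$, sums over empty ranges are $0$, and $|$ stands for $\otimes$: $$\theta_2(z^p,z^ix_s)=0\quad(s\in\mathbb Z),$$ $$\theta_2(z^px^q,z^ix^j)=\Bigl(-\sum_{r=1}^{i}\sum_{s=1}^{q}z^p\sigma^q(z)^{i-r}x^{q-s}\,|\,x^{s-1}z^{r-1}x^j,\ 0,\ 0,\ 0\Bigr),$$ $$\theta_2(z^py^q,z^iy^j)=\Bigl(0,\ -\sum_{r=1}^{i}\sum_{s=1}^{q}z^p\sigma^{-q}(z)^{i-r}y^{q-s}\,|\,y^{s-1}z^{r-1}y^j,\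 0,\ 0\Bigr),$$ $$\theta_2(z^px,z^iy^j)=\Bigl(-\sum_{r=1}^{i}z^p\sigma(z)^{i-r}\,|\,z^{r-1}y^j,\ 0,\ 0,\ z^p\sigma(z^i)\,|\,y^{j-1}\Bigr)\quad(j\ge1),$$ $$\theta_2(z^py,z^ix^j)=\Bigl(0,\ -\sum_{r=1}^{i}z^p\sigma^{-1}(z)^{i-r}\,|\,z^{r-1}x^j,\ z^p\sigma^{-1}(z^i)\,|\,x^{j-1},\ 0\Bigr)\quad(j\ge1).$$ A family $F_n$ ($n\ge2$) integrates $F_1$ if $u*v=uv+\sum_{n\ge1}F_n(u,v)\tau^n$ is a formal deformation of $A$, i.e. its $k[[\tau]]$-bilinear extension to $A[[\tau]]$ is associative. **Theorem.** There is exactly one Hochschild cocycle $F_1$ corresponding to $f(1)$. There is exactly one family of $k$-bilinear maps $F_n\colon A\times A\to A$ ($n\geq 2$) that integrates $F_1$, satisfies (a) and (b) for every $n\ge2$, and has the values $$F_n(x,z)=0,\quad F_n(y,z)=0,\quad F_n(x,y)=\frac{(-1)^n}{n!}\bar\varphi^{(n)}(z),\quad F_n(y,x)=0\qquad(n\ge2).$$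 All the maps $F_n$ ($n\ge1$) preserve $\Gamma$, and $1_A$ is the unit of $(A[[\tau]],*)$. The deformation is locally finite: $u*v\in\tilde A:=A\otimes k[[\tau]]\subset A[[\tau]]$ for all $u,v\in A$, so that $\tilde A$ is a $k[[\tau]]$-subalgebra of $(A[[\tau]],*)$. Its localization $\tilde A_\tau=k((\tau))\otimes_{k[[\tau]]}\tilde A$ is isomorphic, as a $k((\tau))$-algebra and by an isomorphism sending $x,y,z$ to $x,y,z$, to the classical generalized Weyl algebra $k((\tau))[z;1,\eta-\tau,\varphi(z)]$ (in particular $\eta-\tau\neq0$). -/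

import Mathlib

open scoped Polynomial PowerSeries LaurentSeries TensorProduct

/-! ### Generalized Weyl algebras over a polynomial ring in one variable -/

/-- The three generators `x`, `y`, `z`. -/
inductive GWAGen : Type
  | x
  | y
  | z

namespace GWA

section Basic

variable {k : Type*} [Field k]

/-- The algebra endomorphism `σ` of `k[z]` with `σ(z) = lam z + eta` (bijective for `lam ≠ 0`). -/
noncomputable def sigma (lam eta : k) : k[X] →ₐ[k] k[X] :=
  Polynomial.aeval (Polynomial.C lam * Polynomial.X + Polynomial.C eta)

/-- The inverse of `σ` (for `lam ≠ 0`): `σ⁻¹(z) = lam⁻¹ (z - eta)`. -/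
noncomputable def sigmaInv (lam eta : k) : k[X] →ₐ[k] k[X] :=
  Polynomial.aeval (Polynomial.C lam⁻¹ * (Polynomial.X - Polynomial.C eta))

/-- Evaluation of a polynomial at the generator `z` of the free algebra `k⟨x, y, z⟩`. -/
noncomputable def freeEval (p : k[X]) : FreeAlgebra k GWAGen :=
  Polynomial.aeval (FreeAlgebra.ι k GWAGen.z) p

/-- The defining relations `x z = σ(z) x`, `y z = σ⁻¹(z) y`, `y x = φ(z)`, `x y = σ(φ(z))`. -/
inductive Rel (lam eta : k) (φ : k[X]) : FreeAlgebra k GWAGen → FreeAlgebra k GWAGen → Prop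
  | xz : Rel lam eta φ (FreeAlgebra.ι k GWAGen.x * FreeAlgebra.ι k GWAGen.z)
      (freeEval (sigma lam eta Polynomial.X) * FreeAlgebra.ι k GWAGen.x)
  | yz : Rel lam eta φ (FreeAlgebra.ι k GWAGen.y * FreeAlgebra.ι k GWAGen.z)
      (freeEval (sigmaInv lam eta Polynomial.X) * FreeAlgebra.ι k GWAGen.y)
  | yx : Rel lam eta φ (FreeAlgebra.ι k GWAGen.y * FreeAlgebra.ι k GWAGen.x) (freeEval φ)
  | xy : Rel lam eta φ (FreeAlgebra.ι k GWAGen.x * FreeAlgebra.ι k GWAGen.y)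
      (freeEval (sigma lam eta φ))

end Basic

end GWA

/-- The generalized Weyl algebra `k[z; lam, eta, φ(z)]`: the algebra generated over `k[z]` by
`x` and `y` subject to `x b = σ(b) x`, `y b = σ⁻¹(b) y` for `b ∈ k[z]`, `y x = φ`, `x y = σ(φ)`.
(As `k[z]` is generated by `z`, it is enough to impose the first two relations for `b = z`.) -/
def GWA (k : Type*) [Field k] (lam eta : k) (φ : k[X]) : Type _ :=
  RingQuot (GWA.Rel lam eta φ)

namespace GWA

section Elements

variable {k : Type*} [Field k] (lam eta : k) (φ : k[X])

noncomputable instance instRing : Ring (GWA k lam eta φ) :=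
  inferInstanceAs (Ring (RingQuot (GWA.Rel lam eta φ)))

noncomputable instance instAlgebra : Algebra k (GWA k lam eta φ) :=
  inferInstanceAs (Algebra k (RingQuot (GWA.Rel lam eta φ)))

/-- The canonical projection from the free algebra. -/
noncomputable def mk : FreeAlgebra k GWAGen →ₐ[k] GWA k lam eta φ :=
  RingQuot.mkAlgHom k (GWA.Rel lam eta φ)

/-- The generator `x`. -/
noncomputable def x : GWA k lam eta φ := mk lam eta φ (FreeAlgebra.ι k GWAGen.x)

/-- The generator `y`. -/
noncomputable def y : GWA k lam eta φ := mk lam eta φ (FreeAlgebra.ι k GWAGen.y)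

/-- The generator `z`. -/
noncomputable def z : GWA k lam eta φ := mk lam eta φ (FreeAlgebra.ι k GWAGen.z)

/-- The embedding `k[z] → A`, `p ↦ p(z)`. -/
noncomputable def ofPoly : k[X] →ₐ[k] GWA k lam eta φ := Polynomial.aeval (z lam eta φ)

/-- `x_q`, which is `x ^ q` for `q ≥ 0` and `y ^ (-q)` for `q < 0`. -/
noncomputable def xi (q : ℤ) : GWA k lam eta φ :=
  if 0 ≤ q then x lam eta φ ^ q.toNat else y lam eta φ ^ (-q).toNat

/-- The norm `p + (l + 1)|q|` of the basis element `z ^ p x_q`, where `l = deg φ`. -/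
def weight (φ : k[X]) (p : ℕ) (q : ℤ) : ℕ := p + (φ.natDegree + 1) * q.natAbs

/-- The filtration piece `Γⁿ A`, spanned by the basis elements `z ^ p x_q` of norm `≤ n`. -/
noncomputable def Gamma (n : ℕ) : Submodule k (GWA k lam eta φ) :=
  Submodule.span k
    {u | ∃ (p : ℕ) (q : ℤ), weight φ p q ≤ n ∧ u = z lam eta φ ^ p * xi lam eta φ q}

end Elements

end GWA

/-! ### Hochschild 2-cochains and formal deformations -/

/-- `k`-bilinear maps `A × A → A`, i.e. Hochschild 2-cochains of `A` with values in `A`. -/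
abbrev Cochain2 (k A : Type*) [Field k] [Ring A] [Algebra k A] : Type _ := A →ₗ[k] A →ₗ[k] A

section Hochschild

variable {k A : Type*} [Field k] [Ring A] [Algebra k A]

/-- The Hochschild coboundary of a 2-cochain. -/
def hochschildB (F : Cochain2 k A) (a b c : A) : A :=
  a * F b c - F (a * b) c + F a (b * c) - F a b * c

/-- Hochschild 2-cocycles. -/
def IsHochschildCocycle (F : Cochain2 k A) : Prop := ∀ a b c : A, hochschildB F a b c = 0

/-- The `k[[t]]`-bilinear extension to `A[[t]]` of `(u, v) ↦ ∑ₙ Fₙ(u, v) tⁿ`: the coefficient of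
`tⁿ` in the product of `∑ aᵢ tⁱ` and `∑ bⱼ tʲ` is `∑_{m + i + j = n} F_m(aᵢ, bⱼ)`. -/
noncomputable def starMul (F : ℕ → Cochain2 k A) (a b : A⟦X⟧) : A⟦X⟧ :=
  PowerSeries.mk fun n => ∑ p ∈ Finset.HasAntidiagonal.antidiagonal n, ∑ q ∈ Finset.HasAntidiagonal.antidiagonal p.2,
    F p.1 (PowerSeries.coeff q.1 a) (PowerSeries.coeff q.2 b)

/-- The family `F` (with `F₀` the multiplication of `A`) is a formal deformation of `A`: the
product `u * v = uv + F₁(u, v) t + F₂(u, v) t² + ⋯` on `A[[t]]` is associative. -/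
def IsFormalDeformation (F : ℕ → Cochain2 k A) : Prop :=
  F 0 = LinearMap.mul k A ∧
    ∀ a b c : A⟦X⟧, starMul F (starMul F a b) c = starMul F a (starMul F b c)

/-- The family `F₂, F₃, …` integrates `F₁`: together they form a formal deformation of `A`. -/
def Integrates (F₁ : Cochain2 k A) (F : ℕ → Cochain2 k A) : Prop :=
  F 1 = F₁ ∧ IsFormalDeformation F

/-- Condition (a): `F(u, 1) = F(1, v) = 0`. -/
def ConditionA (F : Cochain2 k A) : Prop := ∀ u : A, F u 1 = 0 ∧ F 1 u = 0

theorem coeff_starMul (F : ℕ → Cochain2 k A) (a b : A⟦X⟧) (n : ℕ) :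
    PowerSeries.coeff n (starMul F a b) =
      ∑ p ∈ Finset.HasAntidiagonal.antidiagonal n,
        ∑ q ∈ Finset.HasAntidiagonal.antidiagonal p.2,
          F p.1 (PowerSeries.coeff q.1 a) (PowerSeries.coeff q.2 b) := by
  simp [starMul]

theorem coeff_map_algebraMap_mul (f : k⟦X⟧) (a : A⟦X⟧) (n : ℕ) :
    PowerSeries.coeff n (PowerSeries.map (algebraMap k A) f * a) =
      ∑ p ∈ Finset.HasAntidiagonal.antidiagonal n,
        PowerSeries.coeff p.1 f • PowerSeries.coeff p.2 a := by
  simp [PowerSeries.coeff_mul, Algebra.smul_def]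

theorem starMul_add_left (F : ℕ → Cochain2 k A) (a b c : A⟦X⟧) :
    starMul F (a + b) c = starMul F a c + starMul F b c := by
  ext n
  simp [coeff_starMul, Finset.sum_add_distrib]

theorem starMul_add_right (F : ℕ → Cochain2 k A) (a b c : A⟦X⟧) :
    starMul F a (b + c) = starMul F a b + starMul F a c := by
  ext n
  simp [coeff_starMul, Finset.sum_add_distrib]

theorem starMul_smul_left (F : ℕ → Cochain2 k A) (f : k⟦X⟧) (a b : A⟦X⟧) :
    starMul F (PowerSeries.map (algebraMap k A) f * a) b =
      PowerSeries.map (algebraMap k A) f * starMul F a b := by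
  ext n
  simp only [coeff_starMul, coeff_map_algebraMap_mul, map_sum, map_smul, LinearMap.sum_apply,
    LinearMap.smul_apply, Finset.smul_sum]
  simp only [Finset.sum_sigma']
  refine Finset.sum_bij'
    (fun t _ => ⟨(t.2.2.1, t.1.1 + (t.2.2.2 + t.2.1.2)), ⟨(t.1.1, t.2.2.2 + t.2.1.2),
      (t.2.2.2, t.2.1.2)⟩⟩)
    (fun t _ => ⟨(t.2.1.1, t.1.1 + (t.2.2.1 + t.2.2.2)), ⟨(t.1.1 + t.2.2.1, t.2.2.2),
      (t.1.1, t.2.2.1)⟩⟩) ?_ ?_ ?_ ?_ ?_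
  · rintro ⟨⟨m, r⟩, ⟨i, j⟩, ⟨s, t⟩⟩ h
    simp only [Finset.mem_sigma, Finset.HasAntidiagonal.mem_antidiagonal] at h ⊢
    obtain ⟨h1, h2, h3⟩ := h
    refine ⟨?_, ?_, ?_⟩ <;> first | rfl | trivial | omega
  · rintro ⟨⟨m, r⟩, ⟨i, j⟩, ⟨s, t⟩⟩ h
    simp only [Finset.mem_sigma, Finset.HasAntidiagonal.mem_antidiagonal] at h ⊢
    obtain ⟨h1, h2, h3⟩ := h
    refine ⟨?_, ?_, ?_⟩ <;> first | rfl | trivial | omega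
  · rintro ⟨⟨m, r⟩, ⟨i, j⟩, ⟨s, t⟩⟩ h
    simp only [Finset.mem_sigma, Finset.HasAntidiagonal.mem_antidiagonal] at h
    obtain ⟨h1, h2, h3⟩ := h
    subst h3
    subst h2
    subst h1
    simp [add_assoc]
  · rintro ⟨⟨m, r⟩, ⟨i, j⟩, ⟨s, t⟩⟩ h
    simp only [Finset.mem_sigma, Finset.HasAntidiagonal.mem_antidiagonal] at h
    obtain ⟨h1, h2, h3⟩ := h
    subst h3
    subst h2
    subst h1
    simp
  · rintro ⟨⟨m, r⟩, ⟨i, j⟩, ⟨s, t⟩⟩ _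
    rfl

theorem starMul_smul_right (F : ℕ → Cochain2 k A) (f : k⟦X⟧) (a b : A⟦X⟧) :
    starMul F a (PowerSeries.map (algebraMap k A) f * b) =
      PowerSeries.map (algebraMap k A) f * starMul F a b := by
  ext n
  simp only [coeff_starMul, coeff_map_algebraMap_mul, map_sum, map_smul, Finset.smul_sum]
  simp only [Finset.sum_sigma']
  refine Finset.sum_bij'
    (fun t _ => ⟨(t.2.2.1, t.1.1 + (t.2.1.1 + t.2.2.2)), ⟨(t.1.1, t.2.1.1 + t.2.2.2),
      (t.2.1.1, t.2.2.2)⟩⟩)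
    (fun t _ => ⟨(t.2.1.1, t.2.2.1 + (t.1.1 + t.2.2.2)), ⟨(t.2.2.1, t.1.1 + t.2.2.2),
      (t.1.1, t.2.2.2)⟩⟩) ?_ ?_ ?_ ?_ ?_
  · rintro ⟨⟨m, r⟩, ⟨i, j⟩, ⟨s, t⟩⟩ h
    simp only [Finset.mem_sigma, Finset.HasAntidiagonal.mem_antidiagonal] at h ⊢
    obtain ⟨h1, h2, h3⟩ := h
    refine ⟨?_, ?_, ?_⟩ <;> first | rfl | trivial | omega
  · rintro ⟨⟨m, r⟩, ⟨i, j⟩, ⟨s, t⟩⟩ h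
    simp only [Finset.mem_sigma, Finset.HasAntidiagonal.mem_antidiagonal] at h ⊢
    obtain ⟨h1, h2, h3⟩ := h
    refine ⟨?_, ?_, ?_⟩ <;> first | rfl | trivial | omega
  · rintro ⟨⟨m, r⟩, ⟨i, j⟩, ⟨s, t⟩⟩ h
    simp only [Finset.mem_sigma, Finset.HasAntidiagonal.mem_antidiagonal] at h
    obtain ⟨h1, h2, h3⟩ := h
    subst h3
    subst h2
    subst h1
    simp
  · rintro ⟨⟨m, r⟩, ⟨i, j⟩, ⟨s, t⟩⟩ h
    simp only [Finset.mem_sigma, Finset.HasAntidiagonal.mem_antidiagonal] at h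
    obtain ⟨h1, h2, h3⟩ := h
    subst h3
    subst h2
    subst h1
    simp
  · rintro ⟨⟨m, r⟩, ⟨i, j⟩, ⟨s, t⟩⟩ _
    rfl

theorem sum_antidiagonal_eq_of_fst {M : Type*} [AddCommMonoid M] (n : ℕ) (f : ℕ × ℕ → M)
    (h : ∀ i j, i + 1 + j = n → f (i + 1, j) = 0) :
    ∑ p ∈ Finset.HasAntidiagonal.antidiagonal n, f p = f (0, n) := by
  refine Finset.sum_eq_single_of_mem (0, n) (by simp) ?_
  rintro ⟨i, j⟩ hij hne
  rw [Finset.HasAntidiagonal.mem_antidiagonal] at hij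
  rcases i with _ | i
  · exact absurd (by simpa using hij) (fun hj : j = n => hne (by rw [hj]))
  · exact h i j hij

theorem sum_antidiagonal_eq_of_snd {M : Type*} [AddCommMonoid M] (n : ℕ) (f : ℕ × ℕ → M)
    (h : ∀ i j, i + (j + 1) = n → f (i, j + 1) = 0) :
    ∑ p ∈ Finset.HasAntidiagonal.antidiagonal n, f p = f (n, 0) := by
  refine Finset.sum_eq_single_of_mem (n, 0) (by simp) ?_
  rintro ⟨i, j⟩ hij hne
  rw [Finset.HasAntidiagonal.mem_antidiagonal] at hij
  rcases j with _ | j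
  · exact absurd (by simpa using hij) (fun hj : i = n => hne (by rw [hj]))
  · exact h i j hij

theorem starMul_one_left (F : ℕ → Cochain2 k A) (h0 : F 0 = LinearMap.mul k A)
    (h : ∀ n, 1 ≤ n → ConditionA (F n)) (a : A⟦X⟧) : starMul F 1 a = a := by
  ext n
  rw [coeff_starMul, sum_antidiagonal_eq_of_fst, sum_antidiagonal_eq_of_fst]
  · simp [h0]
  · intro i j _
    simp [PowerSeries.coeff_one]
  · intro i j _
    refine Finset.sum_eq_zero fun q _ => ?_
    rcases hq : q.1 with _ | m
    · simpa [hq] using (h (i + 1) (by omega) _).2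
    · simp [PowerSeries.coeff_one]

theorem starMul_one_right (F : ℕ → Cochain2 k A) (h0 : F 0 = LinearMap.mul k A)
    (h : ∀ n, 1 ≤ n → ConditionA (F n)) (a : A⟦X⟧) : starMul F a 1 = a := by
  ext n
  rw [coeff_starMul, sum_antidiagonal_eq_of_fst, sum_antidiagonal_eq_of_snd]
  · simp [h0]
  · intro i j _
    simp [PowerSeries.coeff_one]
  · intro i j _
    refine Finset.sum_eq_zero fun q _ => ?_
    rcases hq : q.2 with _ | m
    · simpa [hq] using (h (i + 1) (by omega) _).1
    · simp [PowerSeries.coeff_one]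

end Hochschild

/-- A formal deformation of `A` for which `1_A` is still the unit. -/
structure FormalDeformation (k A : Type*) [Field k] [Ring A] [Algebra k A] where
  /-- The structure maps, `F 0` being the multiplication of `A`. -/
  F : ℕ → Cochain2 k A
  isFormalDeformation : IsFormalDeformation F
  unital : ∀ n, 1 ≤ n → ConditionA (F n)

namespace FormalDeformation

variable {k A : Type*} [Field k] [Ring A] [Algebra k A] (D : FormalDeformation k A)

/-- The `k[[t]]`-module `A[[t]]`, to be equipped with the deformed product. -/
def Series (_D : FormalDeformation k A) : Type _ := A⟦X⟧

noncomputable instance : AddCommGroup D.Series := inferInstanceAs (AddCommGroup A⟦X⟧)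

/-- The `k[[t]]`-module structure is the usual one: multiplication of power series. -/
noncomputable instance : Module k⟦X⟧ D.Series :=
  Module.compHom A⟦X⟧ (PowerSeries.map (algebraMap k A))

/-- The constant power series `u`. -/
noncomputable def const (u : A) : D.Series := (PowerSeries.C u : A⟦X⟧)

/-- The ring `(A[[t]], *)`. -/
noncomputable instance : Ring D.Series :=
  { (inferInstance : AddCommGroup D.Series) with
    mul := fun a b => starMul D.F a b
    one := (1 : A⟦X⟧)
    mul_assoc := D.isFormalDeformation.2
    one_mul := starMul_one_left D.F D.isFormalDeformation.1 D.unital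
    mul_one := starMul_one_right D.F D.isFormalDeformation.1 D.unital
    left_distrib := starMul_add_right D.F
    right_distrib := starMul_add_left D.F
    zero_mul := fun a => by
      have h := starMul_add_left D.F 0 0 a
      rw [add_zero] at h
      exact left_eq_add.mp h
    mul_zero := fun a => by
      have h := starMul_add_right D.F a 0 0
      rw [add_zero] at h
      exact left_eq_add.mp h }

/-- `(A[[t]], *)` as a `k[[t]]`-algebra. -/
noncomputable instance : Algebra k⟦X⟧ D.Series :=
  Algebra.ofModule (starMul_smul_left D.F) (fun f a b => starMul_smul_right D.F f a b)

/-- The `k[[t]]`-submodule `A ⊗ k[[t]]` of `A[[t]]`, i.e. the one generated by `A`. -/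
noncomputable def tildeSubmodule : Submodule k⟦X⟧ D.Series :=
  Submodule.span k⟦X⟧ (Set.range D.const)

/-- The deformation is locally finite: `u * v` lies in `A ⊗ k[[t]]` for all `u, v ∈ A`. -/
def IsLocallyFinite : Prop := ∀ u v : A, D.const u * D.const v ∈ D.tildeSubmodule

/-- For a locally finite deformation, the `k[[t]]`-subalgebra `Ã = A ⊗ k[[t]]` of
`(A[[t]], *)`. -/
noncomputable def tilde (h : D.IsLocallyFinite) : Subalgebra k⟦X⟧ D.Series :=
  D.tildeSubmodule.toSubalgebra (Submodule.subset_span ⟨1, map_one (PowerSeries.C (R := A))⟩)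
    (fun a b ha hb => by
      refine Submodule.span_induction₂ (p := fun a b _ _ => a * b ∈ D.tildeSubmodule)
        ?_ ?_ ?_ ?_ ?_ ?_ ?_ ha hb
      · rintro _ _ ⟨u, rfl⟩ ⟨v, rfl⟩
        exact h u v
      · intro b _
        rw [zero_mul]
        exact Submodule.zero_mem _
      · intro a _
        rw [mul_zero]
        exact Submodule.zero_mem _
      · intro a b c _ _ _ h1 h2
        rw [add_mul]
        exact Submodule.add_mem _ h1 h2
      · intro a b c _ _ _ h1 h2
        rw [mul_add]
        exact Submodule.add_mem _ h1 h2
      · intro f a b _ _ h1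
        rw [smul_mul_assoc]
        exact Submodule.smul_mem _ _ h1
      · intro f a b _ _ h1
        rw [mul_smul_comm]
        exact Submodule.smul_mem _ _ h1)

/-- The inclusion `A → Ã`, as a map of sets. -/
noncomputable def ofA (h : D.IsLocallyFinite) (u : A) : D.tilde h :=
  ⟨D.const u, Submodule.subset_span ⟨u, rfl⟩⟩

/-- The locally finite deformation `Ã_t`: the localization of the `k[[t]]`-algebra `Ã` at `t`,
that is, its base change to `k((t)) = k[[t]][1/t]`. -/
abbrev Localized (h : D.IsLocallyFinite) : Type _ := k⸨X⸩ ⊗[k⟦X⟧] D.tilde h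

end FormalDeformation

/-! ### The cocycle `F₁` and the conditions on the family -/

namespace GWA

section Cocycles

variable {k : Type*} [Field k] {lam eta : k} {φ : k[X]}

/-- The action `^σΔ^σ(p) · m = ∑ᵢ aᵢ ∑_{j=1}^{i} σ(z)^(i-j) m σ(z)^(j-1)` on `m ∈ A`, where
`p = ∑ aᵢ zⁱ`. -/
noncomputable def sigmaDeltaSigma (p : k[X]) (m : GWA k lam eta φ) : GWA k lam eta φ :=
  p.sum fun i a => a • ∑ j ∈ Finset.range i,
    ofPoly lam eta φ (sigma lam eta Polynomial.X) ^ (i - 1 - j) * m *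
      ofPoly lam eta φ (sigma lam eta Polynomial.X) ^ j

/-- The Per 2-cocycle `f(m) = (lam m x, - y m, 0, - lam ^σΔ^σ(φ) · m)`, an element of `A⁴`. -/
noncomputable def perCocycle (m : GWA k lam eta φ) :
    GWA k lam eta φ × GWA k lam eta φ × GWA k lam eta φ × GWA k lam eta φ :=
  (lam • (m * x lam eta φ), -(y lam eta φ * m), 0, -(lam • sigmaDeltaSigma φ m))

/-- `F` is a Hochschild 2-cocycle that corresponds to the Per 2-cochain `c` (an element of `A⁴`,
i.e. a bimodule map `(A ⊗ A)⁴ → A`) under the comparison map `θ₂` from the bar resolution to the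
periodic resolution, that is, `F = c ∘ θ₂`, where
* `θ₂(1|zᵖ|v|1) = 0`,
* `θ₂(1|zᵖ x^q|zⁱ xʲ|1) = (- ∑_{r=1}^{i} ∑_{s=1}^{q} zᵖ σ^q(z)^(i-r) x^(q-s)|(lam x)^(s-1) z^(r-1) xʲ, 0, 0, 0)`,
* `θ₂(1|zᵖ y^q|zⁱ yʲ|1) = (0, - ∑_{r=1}^{i} ∑_{s=1}^{q} zᵖ σ^(-q)(z)^(i-r) y^(q-s)|(lam⁻¹ y)^(s-1) z^(r-1) yʲ, 0, 0)`,
* `θ₂(1|zᵖ x|zⁱ yʲ|1) = (- ∑_{r=1}^{i} zᵖ σ(z)^(i-r)|z^(r-1) yʲ, 0, 0, zᵖ σ(zⁱ)|y^(j-1))`, `j ≥ 1`,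
* `θ₂(1|zᵖ y|zⁱ xʲ|1) = (0, - ∑_{r=1}^{i} zᵖ σ⁻¹(z)^(i-r)|z^(r-1) xʲ, zᵖ σ⁻¹(zⁱ)|x^(j-1), 0)`, `j ≥ 1`.
A Hochschild cocycle is determined by its values on these pairs. -/
structure CorrespondsTo (F : Cochain2 k (GWA k lam eta φ))
    (c : GWA k lam eta φ × GWA k lam eta φ × GWA k lam eta φ × GWA k lam eta φ) : Prop where
  cocycle : IsHochschildCocycle F
  z_left : ∀ (p i : ℕ) (q : ℤ),
    F (z lam eta φ ^ p) (z lam eta φ ^ i * xi lam eta φ q) = 0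
  xx : ∀ p q i j : ℕ,
    F (z lam eta φ ^ p * x lam eta φ ^ q) (z lam eta φ ^ i * x lam eta φ ^ j) =
      -∑ r ∈ Finset.range i, ∑ s ∈ Finset.range q,
        z lam eta φ ^ p * ofPoly lam eta φ ((sigma lam eta)^[q] Polynomial.X) ^ (i - 1 - r) *
          x lam eta φ ^ (q - 1 - s) * c.1 *
          (lam • x lam eta φ) ^ s * z lam eta φ ^ r * x lam eta φ ^ j
  yy : ∀ p q i j : ℕ,
    F (z lam eta φ ^ p * y lam eta φ ^ q) (z lam eta φ ^ i * y lam eta φ ^ j) =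
      -∑ r ∈ Finset.range i, ∑ s ∈ Finset.range q,
        z lam eta φ ^ p * ofPoly lam eta φ ((sigmaInv lam eta)^[q] Polynomial.X) ^ (i - 1 - r) *
          y lam eta φ ^ (q - 1 - s) * c.2.1 *
          (lam⁻¹ • y lam eta φ) ^ s * z lam eta φ ^ r * y lam eta φ ^ j
  xy : ∀ p i j : ℕ,
    F (z lam eta φ ^ p * x lam eta φ) (z lam eta φ ^ i * y lam eta φ ^ (j + 1)) =
      -∑ r ∈ Finset.range i,
        z lam eta φ ^ p * ofPoly lam eta φ (sigma lam eta Polynomial.X) ^ (i - 1 - r) * c.1 *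
          z lam eta φ ^ r * y lam eta φ ^ (j + 1) +
      z lam eta φ ^ p * ofPoly lam eta φ (sigma lam eta (Polynomial.X ^ i)) * c.2.2.2 *
        y lam eta φ ^ j
  yx : ∀ p i j : ℕ,
    F (z lam eta φ ^ p * y lam eta φ) (z lam eta φ ^ i * x lam eta φ ^ (j + 1)) =
      -∑ r ∈ Finset.range i,
        z lam eta φ ^ p * ofPoly lam eta φ (sigmaInv lam eta Polynomial.X) ^ (i - 1 - r) *
          c.2.1 * z lam eta φ ^ r * x lam eta φ ^ (j + 1) +
      z lam eta φ ^ p * ofPoly lam eta φ (sigmaInv lam eta (Polynomial.X ^ i)) * c.2.2.1 *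
        x lam eta φ ^ j

/-- Condition (b): `F(zu, v) = z F(u, v)` and `F(x^q, xʲ) = F(y^q, yʲ) = 0`. -/
def ConditionB (F : Cochain2 k (GWA k lam eta φ)) : Prop :=
  (∀ u v, F (z lam eta φ * u) v = z lam eta φ * F u v) ∧
    ∀ q j : ℕ, F (x lam eta φ ^ q) (x lam eta φ ^ j) = 0 ∧
      F (y lam eta φ ^ q) (y lam eta φ ^ j) = 0

/-- `F(x,z) = 0`, `F(y,z) = 0`, `F(x,y) = ((-1)ⁿ / n!) φ̄⁽ⁿ⁾(z)` and `F(y,x) = 0`, where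
`φ̄ = σ(φ)`. -/
def HasClassicalValues (n : ℕ) (F : Cochain2 k (GWA k lam eta φ)) : Prop :=
  F (x lam eta φ) (z lam eta φ) = 0 ∧
  F (y lam eta φ) (z lam eta φ) = 0 ∧
  F (x lam eta φ) (y lam eta φ) = ((-1 : k) ^ n / (n.factorial : k)) •
    ofPoly lam eta φ (Polynomial.derivative^[n] (sigma lam eta φ)) ∧
  F (y lam eta φ) (x lam eta φ) = 0

/-- `F` preserves the filtration `Γ`: `F(b, b') ∈ Γ^(‖b‖ + ‖b'‖) A` for all basis elements. -/
def PreservesGamma (F : Cochain2 k (GWA k lam eta φ)) : Prop :=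
  ∀ (p p' : ℕ) (q q' : ℤ),
    F (z lam eta φ ^ p * xi lam eta φ q) (z lam eta φ ^ p' * xi lam eta φ q') ∈
      Gamma lam eta φ (weight φ p q + weight φ p' q')

end Cocycles

end GWA

/-- The formal parameter `τ` as an element of the field `k((τ))`. -/
noncomputable def laurentTau (k : Type*) [Field k] : k⸨X⸩ := HahnSeries.single (1 : ℤ) (1 : k)

/-- The embedding of constants `k → k((τ))`. -/
noncomputable def laurentConst (k : Type*) [Field k] : k →+* k⸨X⸩ := HahnSeries.C

/-! The deformation is not built order by order. It is read off from one algebra `H` over `k[τ]`,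
the generalized Weyl algebra with shift `η - τ`. Both `A` and `H` have the monomials `z ^ p x_q` as
a basis, over `k` and over `k[τ]`. Identifying the bases, multiplying in `H` and taking the
coefficient of `τ ^ n` defines `F_n`. Associativity in `H` passes to `A[[τ]]`, because a coefficient
of a product depends on finitely many coefficients of the factors. Local finiteness is clear, since
products in `H` have coefficients in `k[τ]`.

The basis comes from a faithful model: on `R[z]` let `x` act as `f(z) ↦ f(z + h)`, `y` as `f(z) ↦
φ(z) f(z - h)` and `z` by multiplication. The relations let monomials span. Independence is
Dedekind's theorem on characters, applied to the shifts by `q h`, which are distinct when `h ≠ 0` in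
a domain of characteristic zero (`ShiftOperator.linearIndependent_monomial`).

All values of `F_n` follow from `x ^ q g(z) = g(z + q(η - τ)) x ^ q` and Taylor's formula
(`tauCoeff_taylor`): up to powers of the coefficient of `τ` they are Hasse derivatives. For `n = 1`
these are the derivatives hidden in the double sums of `θ₂`, so `F_1` corresponds to `f(1)`.

For uniqueness, two families agreeing below order `n` differ at order `n` by a Hochschild cocycle.
The `a` with `F(a, ·) = 0` are closed under products, so generators suffice in the first argument;
(a), (b) and the prescribed values then force zero (`cocycle_eq_zero`).

Finally, the universal property over `k((τ))` gives a map to the localization of `Ã` that carries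
monomials to a basis, hence an isomorphism. -/

/-- Elements `x, y, z` of an `R`-algebra satisfying the relations of the generalized Weyl algebra
with `σ(z) = z + h` over a commutative ring `R`. -/
structure GWATriple {R B : Type*} [CommRing R] [Ring B] [Algebra R B] (h : R) (φ : R[X])
    (x y z : B) : Prop where
  xz : x * z = (z + algebraMap R B h) * x
  yz : y * z = (z - algebraMap R B h) * y
  yx : y * x = Polynomial.aeval z φ
  xy : x * y = Polynomial.aeval z (Polynomial.taylor h φ)

/-- `x ^ q` for `q ≥ 0` and `y ^ (-q)` for `q < 0`. -/
def gwaXi {B : Type*} [Monoid B] (x y : B) (q : ℤ) : B :=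
  if 0 ≤ q then x ^ q.toNat else y ^ (-q).toNat

section Xi

variable {B : Type*} [Monoid B] (x y : B)

theorem gwaXi_natCast (n : ℕ) : gwaXi x y n = x ^ n := by
  simp [gwaXi]

theorem gwaXi_neg_natCast (n : ℕ) : gwaXi x y (-n) = y ^ n := by
  rcases n with _ | n
  · simp [gwaXi]
  · rw [gwaXi, if_neg (by push_cast; omega)]
    simp

theorem gwaXi_zero : gwaXi x y 0 = 1 := by
  simp [gwaXi]

theorem map_gwaXi {C F : Type*} [Monoid C] [FunLike F B C] [MonoidHomClass F B C] (f : F) (q : ℤ) :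
    f (gwaXi x y q) = gwaXi (f x) (f y) q := by
  unfold gwaXi
  split_ifs <;> simp

end Xi

/-- The monomials `z ^ p x_q`. -/
def gwaMonomial {B : Type*} [Monoid B] (x y z : B) (i : ℕ × ℤ) : B := z ^ i.1 * gwaXi x y i.2

theorem map_gwaMonomial {B C F : Type*} [Monoid B] [Monoid C] [FunLike F B C]
    [MonoidHomClass F B C] (x y z : B) (f : F) (i : ℕ × ℤ) : f (gwaMonomial x y z i) = gwaMonomial (f x) (f y) (f z) i := by
  simp [gwaMonomial, map_gwaXi]

/-- The span of the monomials `z ^ p x_q` with `p + (l + 1)|q| ≤ n`. -/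
def gwaFiltration (R : Type*) {B : Type*} [CommRing R] [Ring B] [Algebra R B] (x y z : B)
    (l n : ℕ) : Submodule R B :=
  Submodule.span R {u | ∃ (p : ℕ) (q : ℤ), p + (l + 1) * q.natAbs ≤ n ∧ u = z ^ p * gwaXi x y q}

/-! ### Commutation rules, normal ordering and the filtration over a commutative ring. -/

namespace GWATriple

variable {R B : Type*} [CommRing R] [Ring B] [Algebra R B] {h : R} {φ : R[X]} {x y z : B}

section Map

variable {R' B' : Type*} [CommRing R'] [Ring B'] [Algebra R' B']

/-- The map `g` is only semilinear along `f`: this carries the relations from `k[τ]` to `k((τ))`. -/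
theorem map (t : GWATriple h φ x y z) (f : R →+* R') (g : B →+* B')
    (hfg : ∀ r, g (algebraMap R B r) = algebraMap R' B' (f r)) :
    GWATriple (f h) (φ.map f) (g x) (g y) (g z) := by
  have key : ∀ p : R[X], g (Polynomial.aeval z p) = Polynomial.aeval (g z) (p.map f) := by
    intro p
    rw [Polynomial.aeval_def, Polynomial.aeval_def, Polynomial.eval₂_map, Polynomial.hom_eval₂]
    congr 1
    ext r
    exact hfg r
  refine ⟨?_, ?_, ?_, ?_⟩
  · rw [← map_mul, t.xz, map_mul, map_add, hfg]
  · rw [← map_mul, t.yz, map_mul, map_sub, hfg]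
  · rw [← map_mul, t.yx, key]
  · rw [← map_mul, t.xy, key, Polynomial.taylor_apply, Polynomial.taylor_apply,
      Polynomial.map_comp]
    simp

end Map

theorem x_mul_aeval (t : GWATriple h φ x y z) (p : R[X]) :
    x * Polynomial.aeval z p = Polynomial.aeval z (Polynomial.taylor h p) * x := by
  induction p using Polynomial.induction_on' with
  | add p q hp hq => simp only [map_add, mul_add, add_mul, hp, hq]
  | monomial n a =>
    have hpow : ∀ n : ℕ, x * z ^ n = (z + algebraMap R B h) ^ n * x := by
      intro n
      induction n with
      | zero => simp
      | succ n ih => rw [pow_succ, ← mul_assoc, ih, mul_assoc, t.xz, ← mul_assoc, pow_succ]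
    rw [Polynomial.taylor_monomial, Polynomial.aeval_monomial, ← mul_assoc,
      ← Algebra.commutes, mul_assoc, hpow]
    simp [mul_assoc]

theorem y_mul_aeval (t : GWATriple h φ x y z) (p : R[X]) :
    y * Polynomial.aeval z p = Polynomial.aeval z (Polynomial.taylor (-h) p) * y := by
  induction p using Polynomial.induction_on' with
  | add p q hp hq => simp only [map_add, mul_add, add_mul, hp, hq]
  | monomial n a =>
    have hpow : ∀ n : ℕ, y * z ^ n = (z - algebraMap R B h) ^ n * y := by
      intro n
      induction n with
      | zero => simp
      | succ n ih => rw [pow_succ, ← mul_assoc, ih, mul_assoc, t.yz, ← mul_assoc, pow_succ]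
    rw [Polynomial.taylor_monomial, Polynomial.aeval_monomial, ← mul_assoc,
      ← Algebra.commutes, mul_assoc, hpow]
    simp [mul_assoc, sub_eq_add_neg]

theorem x_pow_mul_aeval (t : GWATriple h φ x y z) (q : ℕ) (p : R[X]) :
    x ^ q * Polynomial.aeval z p = Polynomial.aeval z (Polynomial.taylor (q * h) p) * x ^ q := by
  induction q with
  | zero => simp
  | succ q ih =>
    rw [pow_succ', mul_assoc, ih, ← mul_assoc, t.x_mul_aeval, Polynomial.taylor_taylor, mul_assoc]
    congr 4
    push_cast
    ring

theorem y_pow_mul_aeval (t : GWATriple h φ x y z) (q : ℕ) (p : R[X]) :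
    y ^ q * Polynomial.aeval z p =
      Polynomial.aeval z (Polynomial.taylor (-(q * h)) p) * y ^ q := by
  induction q with
  | zero => simp
  | succ q ih =>
    rw [pow_succ', mul_assoc, ih, ← mul_assoc, t.y_mul_aeval, Polynomial.taylor_taylor, mul_assoc]
    congr 4
    push_cast
    ring

theorem x_mul_y_pow_succ (t : GWATriple h φ x y z) (j : ℕ) :
    x * y ^ (j + 1) = Polynomial.aeval z (Polynomial.taylor h φ) * y ^ j := by
  rw [pow_succ', ← mul_assoc, t.xy]

theorem y_mul_x_pow_succ (t : GWATriple h φ x y z) (j : ℕ) :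
    y * x ^ (j + 1) = Polynomial.aeval z φ * x ^ j := by
  rw [pow_succ', ← mul_assoc, t.yx]

theorem x_mul_xi_of_nonneg {q : ℤ} (hq : 0 ≤ q) : x * gwaXi x y q = gwaXi x y (q + 1) := by
  lift q to ℕ using hq
  rw [gwaXi_natCast, ← pow_succ', ← gwaXi_natCast x y]
  simp

theorem x_mul_xi_of_neg (t : GWATriple h φ x y z) {q : ℤ} (hq : q < 0) :
    x * gwaXi x y q = Polynomial.aeval z (Polynomial.taylor h φ) * gwaXi x y (q + 1) := by
  obtain ⟨n, rfl⟩ : ∃ n : ℕ, q = -((n + 1 : ℕ) : ℤ) := ⟨(-q - 1).toNat, by omega⟩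
  rw [gwaXi_neg_natCast, t.x_mul_y_pow_succ, ← gwaXi_neg_natCast x y]
  congr 2
  push_cast
  ring

theorem y_mul_xi_of_nonpos {q : ℤ} (hq : q ≤ 0) : y * gwaXi x y q = gwaXi x y (q - 1) := by
  obtain ⟨n, rfl⟩ : ∃ n : ℕ, q = -(n : ℤ) := ⟨(-q).toNat, by omega⟩
  rw [gwaXi_neg_natCast, ← pow_succ', ← gwaXi_neg_natCast x y]
  congr 1
  push_cast
  ring

theorem y_mul_xi_of_pos (t : GWATriple h φ x y z) {q : ℤ} (hq : 0 < q) :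
    y * gwaXi x y q = Polynomial.aeval z φ * gwaXi x y (q - 1) := by
  obtain ⟨n, rfl⟩ : ∃ n : ℕ, q = ((n + 1 : ℕ) : ℤ) := ⟨(q - 1).toNat, by omega⟩
  rw [gwaXi_natCast, t.y_mul_x_pow_succ, ← gwaXi_natCast x y]
  congr 2
  push_cast
  ring

theorem aeval_mul_xi_mem_filtration {l n : ℕ} {p : R[X]} {q : ℤ}
    (hpq : p.natDegree + (l + 1) * q.natAbs ≤ n) :
    Polynomial.aeval z p * gwaXi x y q ∈ gwaFiltration R x y z l n := by
  rw [Polynomial.aeval_eq_sum_range, Finset.sum_mul]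
  refine Submodule.sum_mem _ fun j hj => ?_
  rw [smul_mul_assoc]
  refine Submodule.smul_mem _ _ (Submodule.subset_span ⟨j, q, ?_, rfl⟩)
  rw [Finset.mem_range] at hj
  omega

theorem z_pow_eq_aeval (p : ℕ) : z ^ p = Polynomial.aeval z (Polynomial.X ^ p : R[X]) := by
  simp

theorem z_mul_mem_filtration {l n : ℕ} {w : B} (hw : w ∈ gwaFiltration R x y z l n) :
    z * w ∈ gwaFiltration R x y z l (n + 1) := by
  induction hw using Submodule.span_induction with
  | zero => simp
  | add u v _ _ hu hv => rw [mul_add]; exact Submodule.add_mem _ hu hv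
  | smul r u _ hu => rw [mul_smul_comm]; exact Submodule.smul_mem _ _ hu
  | mem u hu =>
    obtain ⟨p, q, hpq, rfl⟩ := hu
    refine Submodule.subset_span ⟨p + 1, q, by omega, ?_⟩
    rw [pow_succ', mul_assoc]

/-- Multiplying by `x` either raises `|q|` by one, costing exactly `l + 1`, or cancels a `y` and
inserts a shift of `φ`, costing at most `l`. This is why the weight of `x` and `y` is `l + 1`. -/
theorem x_mul_mem_filtration (t : GWATriple h φ x y z) {l n : ℕ} (hl : φ.natDegree ≤ l) {w : B}
    (hw : w ∈ gwaFiltration R x y z l n) :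
    x * w ∈ gwaFiltration R x y z l (n + (l + 1)) := by
  induction hw using Submodule.span_induction with
  | zero => simp
  | add u v _ _ hu hv => rw [mul_add]; exact Submodule.add_mem _ hu hv
  | smul r u _ hu => rw [mul_smul_comm]; exact Submodule.smul_mem _ _ hu
  | mem u hu =>
    obtain ⟨p, q, hpq, rfl⟩ := hu
    have h1 := Polynomial.natDegree_X_pow_le (R := R) p
    rw [z_pow_eq_aeval (R := R), ← mul_assoc, t.x_mul_aeval, mul_assoc]
    rcases le_or_gt 0 q with hq | hq
    · rw [x_mul_xi_of_nonneg hq]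
      refine aeval_mul_xi_mem_filtration ?_
      have e : (q + 1).natAbs = q.natAbs + 1 := by omega
      rw [Polynomial.natDegree_taylor, e, mul_add]
      omega
    · rw [t.x_mul_xi_of_neg hq, ← mul_assoc, ← map_mul, ← Polynomial.taylor_mul]
      refine aeval_mul_xi_mem_filtration ?_
      have e : (q + 1).natAbs ≤ q.natAbs := by omega
      have e' := Nat.mul_le_mul_left (l + 1) e
      have h2 := Polynomial.natDegree_mul_le (p := (Polynomial.X ^ p : R[X])) (q := φ)
      rw [Polynomial.natDegree_taylor]
      omega

theorem y_mul_mem_filtration (t : GWATriple h φ x y z) {l n : ℕ} (hl : φ.natDegree ≤ l) {w : B}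
    (hw : w ∈ gwaFiltration R x y z l n) :
    y * w ∈ gwaFiltration R x y z l (n + (l + 1)) := by
  induction hw using Submodule.span_induction with
  | zero => simp
  | add u v _ _ hu hv => rw [mul_add]; exact Submodule.add_mem _ hu hv
  | smul r u _ hu => rw [mul_smul_comm]; exact Submodule.smul_mem _ _ hu
  | mem u hu =>
    obtain ⟨p, q, hpq, rfl⟩ := hu
    have h1 := Polynomial.natDegree_X_pow_le (R := R) p
    rw [z_pow_eq_aeval (R := R), ← mul_assoc, t.y_mul_aeval, mul_assoc]
    rcases le_or_gt q 0 with hq | hq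
    · rw [y_mul_xi_of_nonpos hq]
      refine aeval_mul_xi_mem_filtration ?_
      have e : (q - 1).natAbs = q.natAbs + 1 := by omega
      rw [Polynomial.natDegree_taylor, e, mul_add]
      omega
    · rw [t.y_mul_xi_of_pos hq, ← mul_assoc, ← map_mul]
      refine aeval_mul_xi_mem_filtration ?_
      have e : (q - 1).natAbs ≤ q.natAbs := by omega
      have e' := Nat.mul_le_mul_left (l + 1) e
      have h2 := Polynomial.natDegree_mul_le
        (p := Polynomial.taylor (-h) (Polynomial.X ^ p : R[X])) (q := φ)
      rw [Polynomial.natDegree_taylor] at h2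
      omega

theorem monomial_mul_mem_filtration (t : GWATriple h φ x y z) {l n : ℕ} (hl : φ.natDegree ≤ l)
    {w : B} (hw : w ∈ gwaFiltration R x y z l n) (i : ℕ × ℤ) :
    gwaMonomial x y z i * w ∈ gwaFiltration R x y z l (i.1 + (l + 1) * i.2.natAbs + n) := by
  have hpow : ∀ (u : B) (d : ℕ), (∀ n w, w ∈ gwaFiltration R x y z l n →
      u * w ∈ gwaFiltration R x y z l (n + d)) → ∀ (m n : ℕ) (w : B),
      w ∈ gwaFiltration R x y z l n → u ^ m * w ∈ gwaFiltration R x y z l (n + d * m) := by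
    intro u d hu m
    induction m with
    | zero => simp
    | succ m ih =>
      intro n w hw
      rw [pow_succ', mul_assoc, mul_add, ← add_assoc, mul_one]
      exact hu _ _ (ih n w hw)
  have hxi : gwaXi x y i.2 * w ∈ gwaFiltration R x y z l (n + (l + 1) * i.2.natAbs) := by
    unfold gwaXi
    split_ifs with hq
    · rw [show i.2.natAbs = i.2.toNat by omega]
      exact hpow x (l + 1) (fun n w hw => t.x_mul_mem_filtration hl hw) _ _ _ hw
    · rw [show i.2.natAbs = (-i.2).toNat by omega]
      exact hpow y (l + 1) (fun n w hw => t.y_mul_mem_filtration hl hw) _ _ _ hw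
  have := hpow z 1 (fun n w hw => z_mul_mem_filtration hw) i.1 _ _ hxi
  rw [gwaMonomial, mul_assoc]
  convert this using 2
  ring

theorem monomial_mul_monomial_mem_filtration (t : GWATriple h φ x y z) (i j : ℕ × ℤ) :
    gwaMonomial x y z i * gwaMonomial x y z j ∈
      gwaFiltration R x y z φ.natDegree (i.1 + (φ.natDegree + 1) * i.2.natAbs +
        (j.1 + (φ.natDegree + 1) * j.2.natAbs)) :=
  t.monomial_mul_mem_filtration le_rfl (Submodule.subset_span ⟨j.1, j.2, le_rfl, rfl⟩) i

theorem filtration_le_span_monomial (l n : ℕ) :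
    gwaFiltration R x y z l n ≤ Submodule.span R (Set.range (gwaMonomial x y z)) := by
  refine Submodule.span_mono ?_
  rintro _ ⟨p, q, _, rfl⟩
  exact ⟨(p, q), rfl⟩

/-- The span contains `1` and is stable under left multiplication by the generators; the stability
is a by-product of the filtration estimates. -/
theorem span_monomial_eq_top (t : GWATriple h φ x y z)
    (hadj : Algebra.adjoin R {x, y, z} = ⊤) :
    Submodule.span R (Set.range (gwaMonomial x y z)) = ⊤ := by
  have key : ∀ a ∈ Algebra.adjoin R {x, y, z},
      ∀ w ∈ Submodule.span R (Set.range (gwaMonomial x y z)),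
        a * w ∈ Submodule.span R (Set.range (gwaMonomial x y z)) := by
    have hgen : ∀ a : B, (∀ i, a * gwaMonomial x y z i ∈
        Submodule.span R (Set.range (gwaMonomial x y z))) →
        ∀ w ∈ Submodule.span R (Set.range (gwaMonomial x y z)),
          a * w ∈ Submodule.span R (Set.range (gwaMonomial x y z)) := by
      intro a ha w hw
      induction hw using Submodule.span_induction with
      | zero => simp
      | add u v _ _ hu hv => rw [mul_add]; exact Submodule.add_mem _ hu hv
      | smul r u _ hu => rw [mul_smul_comm]; exact Submodule.smul_mem _ _ hu
      | mem u hu =>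
        obtain ⟨i, rfl⟩ := hu
        exact ha i
    intro a ha
    induction ha using Algebra.adjoin_induction with
    | mem u hu =>
      refine hgen u fun i => ?_
      have hi : gwaMonomial x y z i ∈ gwaFiltration R x y z φ.natDegree
          (i.1 + (φ.natDegree + 1) * i.2.natAbs) :=
        Submodule.subset_span ⟨i.1, i.2, le_rfl, rfl⟩
      rcases hu with rfl | rfl | rfl
      · exact filtration_le_span_monomial _ _ (t.x_mul_mem_filtration le_rfl hi)
      · exact filtration_le_span_monomial _ _ (t.y_mul_mem_filtration le_rfl hi)
      · exact filtration_le_span_monomial _ _ (z_mul_mem_filtration hi)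
    | algebraMap r =>
      intro w hw
      rw [← Algebra.smul_def]
      exact Submodule.smul_mem _ _ hw
    | add a b _ _ ha hb =>
      intro w hw
      rw [add_mul]
      exact Submodule.add_mem _ (ha w hw) (hb w hw)
    | mul a b _ _ ha hb =>
      intro w hw
      rw [mul_assoc]
      exact ha _ (hb w hw)
  refine Submodule.eq_top_iff'.2 fun a => ?_
  have h1 := key a (hadj ▸ Algebra.mem_top) 1
    (Submodule.subset_span ⟨(0, 0), by simp [gwaMonomial, gwaXi_zero]⟩)
  rwa [mul_one] at h1

end GWATriple

/-! ### The representation by shift operators on polynomials -/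

namespace ShiftOperator

variable {R : Type*} [CommRing R]

/-- The shift `f(z) ↦ f(z + h)`. -/
noncomputable def opX (h : R) : Module.End R R[X] := Polynomial.taylor h

/-- The operator `f(z) ↦ φ(z) f(z - h)`. -/
noncomputable def opY (h : R) (φ : R[X]) : Module.End R R[X] :=
  LinearMap.mulLeft R φ * Polynomial.taylor (-h)

/-- Multiplication by `z`. -/
noncomputable def opZ : Module.End R R[X] := LinearMap.mulLeft R Polynomial.X

theorem aeval_opZ (p : R[X]) : Polynomial.aeval (opZ (R := R)) p = LinearMap.mulLeft R p := by
  have h1 : opZ (R := R) = Algebra.lmul R R[X] Polynomial.X := rfl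
  have h2 : LinearMap.mulLeft R p = Algebra.lmul R R[X] p := rfl
  rw [h1, h2, Polynomial.aeval_algHom_apply, Polynomial.aeval_X_left_apply]

theorem triple (h : R) (φ : R[X]) :
    GWATriple h φ (opX h) (opY h φ) (opZ (R := R)) := by
  refine ⟨?_, ?_, ?_, ?_⟩
  · refine LinearMap.ext fun f => ?_
    simp [opX, opZ, Polynomial.taylor_mul, Algebra.algebraMap_eq_smul_one, add_mul,
      Polynomial.smul_eq_C_mul]
  · refine LinearMap.ext fun f => ?_
    simp [opY, opZ, Polynomial.taylor_mul, Algebra.algebraMap_eq_smul_one, Polynomial.smul_eq_C_mul]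
    ring_nf
  · rw [aeval_opZ]
    refine LinearMap.ext fun f => ?_
    simp [opX, opY, Polynomial.taylor_taylor]
  · rw [aeval_opZ]
    refine LinearMap.ext fun f => ?_
    simp [opX, opY, Polynomial.taylor_mul, Polynomial.taylor_taylor]

theorem opX_pow_apply (h : R) (n : ℕ) (f : R[X]) :
    (opX h ^ n) f = Polynomial.taylor (n * h) f := by
  induction n generalizing f with
  | zero => simp
  | succ n ih =>
    rw [pow_succ', Module.End.mul_apply, ih, opX, Polynomial.taylor_taylor]
    congr 2
    push_cast
    ring

/-- The multiplier is a product of shifts of `φ`, nonzero over a domain. So `y ^ n` is, up to a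
nonzero factor, the pure shift by `-n h`. -/
theorem exists_opY_pow_apply [IsDomain R] (h : R) {φ : R[X]} (hφ : φ ≠ 0) (n : ℕ) :
    ∃ c : R[X], c ≠ 0 ∧ ∀ f, (opY h φ ^ n) f = c * Polynomial.taylor (-(n * h)) f := by
  induction n with
  | zero => exact ⟨1, one_ne_zero, fun f => by simp⟩
  | succ n ih =>
    obtain ⟨c, hc, hcf⟩ := ih
    refine ⟨φ * Polynomial.taylor (-h) c, mul_ne_zero hφ ?_, fun f => ?_⟩
    · rwa [Ne, LinearMap.map_eq_zero_iff _ (Polynomial.taylor_injective _)]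
    · rw [pow_succ', Module.End.mul_apply, hcf, opY, Module.End.mul_apply, Polynomial.taylor_mul,
        Polynomial.taylor_taylor, LinearMap.mulLeft_apply, mul_assoc]
      congr 4
      push_cast
      ring

theorem exists_xi_apply [IsDomain R] (h : R) {φ : R[X]} (hφ : φ ≠ 0) (q : ℤ) :
    ∃ c : R[X], c ≠ 0 ∧ ∀ f, gwaXi (opX h) (opY h φ) q f = c * Polynomial.taylor (q * h) f := by
  rcases le_or_gt 0 q with hq | hq
  · lift q to ℕ using hq
    refine ⟨1, one_ne_zero, fun f => ?_⟩
    rw [gwaXi_natCast, opX_pow_apply]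
    simp
  · obtain ⟨n, rfl⟩ : ∃ n : ℕ, q = -(n : ℤ) := ⟨(-q).toNat, by omega⟩
    obtain ⟨c, hc, hcf⟩ := exists_opY_pow_apply h hφ n
    refine ⟨c, hc, fun f => ?_⟩
    rw [gwaXi_neg_natCast, hcf]
    simp

/-- Dedekind's independence of characters for the multiplicative monoid of `R[X]`. The shifts are
distinct because the image of `X` recovers `q * h`, hence `q`. -/
theorem linearIndependent_taylor [IsDomain R] [CharZero R] {h : R} (hh : h ≠ 0) :
    LinearIndependent R[X] (fun (q : ℤ) (f : R[X]) => Polynomial.taylor (q * h) f) := by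
  have hd := linearIndependent_monoidHom R[X] R[X]
  let m : ℤ → (R[X] →* R[X]) := fun q =>
    ((Polynomial.taylorAlgHom ((q : R) * h) : R[X] →ₐ[R] R[X]) : R[X] →* R[X])
  have hm : Function.Injective m := by
    intro q q' hqq
    have h1 := DFunLike.congr_fun hqq Polynomial.X
    simp only [m, MonoidHom.coe_coe, Polynomial.taylorAlgHom_apply, Polynomial.taylor_X] at h1
    have h2 := Polynomial.C_injective (add_left_cancel h1)
    exact_mod_cast mul_right_cancel₀ hh h2
  exact hd.comp m hm

/-- Independence of the `x_q` over `R[X]` and of the powers of `z` over `R` multiply, as in the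
tower law. -/
theorem linearIndependent_monomial [IsDomain R] [CharZero R] {h : R} (hh : h ≠ 0) {φ : R[X]}
    (hφ : φ ≠ 0) :
    LinearIndependent R (gwaMonomial (opX h) (opY h φ) (opZ (R := R))) := by
  choose c hc hcf using exists_xi_apply h hφ
  have h1 : LinearIndependent R[X] (fun (q : ℤ) (f : R[X]) => gwaXi (opX h) (opY h φ) q f) := by
    have h0 := linearIndependent_taylor (R := R) hh
    rw [linearIndependent_iff'] at h0 ⊢
    intro s g hg q hq
    have := h0 s (fun q => g q * c q) ?_ q hq
    · exact (mul_eq_zero.1 this).resolve_right (hc q)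
    · rw [← hg]
      refine Finset.sum_congr rfl fun q _ => ?_
      funext f
      simp [hcf, mul_assoc]
  have h2 : LinearIndependent R (fun p : ℕ => (Polynomial.X ^ p : R[X])) := by
    convert (Polynomial.basisMonomials R).linearIndependent using 1
    funext p
    simp [Polynomial.X_pow_eq_monomial]
  have h3 := linearIndependent_smul h2 h1
  -- Operators are viewed as plain functions, the setting of Dedekind's theorem.
  refine LinearIndependent.of_comp
    ({ toFun := fun g f => g f, map_add' := fun _ _ => rfl, map_smul' := fun _ _ => rfl } :
      Module.End R R[X] →ₗ[R] (R[X] → R[X])) ?_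
  convert h3 using 1
  funext i f
  have : (opZ (R := R)) ^ i.1 = LinearMap.mulLeft R (Polynomial.X ^ i.1) := by
    rw [← aeval_opZ]; simp
  simp [gwaMonomial, this]

end ShiftOperator

/-! ### Universal property and monomial basis of the generalized Weyl algebra. -/

namespace GWA

section UniversalProperty

variable {K : Type*} [Field K] (h : K) (φ : K[X])

theorem mk_freeEval (p : K[X]) : mk 1 h φ (freeEval p) = Polynomial.aeval (z 1 h φ) p := by
  rw [freeEval, ← Polynomial.aeval_algHom_apply]
  rfl

theorem sigma_one_eq_taylor (p : K[X]) : sigma 1 h p = Polynomial.taylor h p := by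
  simp [sigma, Polynomial.taylor_apply, Polynomial.comp_eq_aeval]

theorem sigmaInv_one_eq_taylor (p : K[X]) : sigmaInv 1 h p = Polynomial.taylor (-h) p := by
  simp [sigmaInv, Polynomial.taylor_apply, Polynomial.comp_eq_aeval, sub_eq_add_neg]

theorem triple : GWATriple h φ (x 1 h φ) (y 1 h φ) (z 1 h φ) := by
  have hrel : ∀ {a b}, Rel 1 h φ a b → mk 1 h φ a = mk 1 h φ b := fun r =>
    RingQuot.mkAlgHom_rel K r
  refine ⟨?_, ?_, ?_, ?_⟩
  · have := hrel Rel.xz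
    rw [map_mul, map_mul, mk_freeEval, sigma_one_eq_taylor] at this
    simp only [map_add, Polynomial.taylor_X, Polynomial.aeval_X,
      Polynomial.aeval_C] at this
    exact this
  · have := hrel Rel.yz
    rw [map_mul, map_mul, mk_freeEval, sigmaInv_one_eq_taylor] at this
    simp only [Polynomial.taylor_X, map_neg, ← sub_eq_add_neg, map_sub, Polynomial.aeval_X,
      Polynomial.aeval_C] at this
    exact this
  · have := hrel Rel.yx
    rwa [map_mul, mk_freeEval] at this
  · have := hrel Rel.xy
    rwa [map_mul, mk_freeEval, sigma_one_eq_taylor] at this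

theorem adjoin_eq_top : Algebra.adjoin K {x 1 h φ, y 1 h φ, z 1 h φ} = ⊤ := by
  have hsurj : Function.Surjective (mk 1 h φ) := RingQuot.mkAlgHom_surjective K _
  have h1 : (⊤ : Subalgebra K (GWA K 1 h φ)) =
      (⊤ : Subalgebra K (FreeAlgebra K GWAGen)).map (mk 1 h φ) := by
    rw [Algebra.map_top, (AlgHom.range_eq_top _).2 hsurj]
  rw [h1, ← FreeAlgebra.adjoin_range_ι, AlgHom.map_adjoin]
  congr 1
  ext a
  constructor
  · rintro (rfl | rfl | rfl)
    · exact ⟨_, ⟨GWAGen.x, rfl⟩, rfl⟩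
    · exact ⟨_, ⟨GWAGen.y, rfl⟩, rfl⟩
    · exact ⟨_, ⟨GWAGen.z, rfl⟩, rfl⟩
  · rintro ⟨_, ⟨g, rfl⟩, rfl⟩
    rcases g with _ | _ | _
    · exact Or.inl rfl
    · exact Or.inr (Or.inl rfl)
    · exact Or.inr (Or.inr rfl)

theorem exists_algHom {B : Type*} [Ring B] [Algebra K B] {x' y' z' : B}
    (t : GWATriple h φ x' y' z') :
    ∃ f : GWA K 1 h φ →ₐ[K] B, f (x 1 h φ) = x' ∧ f (y 1 h φ) = y' ∧ f (z 1 h φ) = z' := by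
  let v : GWAGen → B := fun g => match g with
    | GWAGen.x => x'
    | GWAGen.y => y'
    | GWAGen.z => z'
  have hp : ∀ p : K[X], FreeAlgebra.lift K v (freeEval p) = Polynomial.aeval z' p := by
    intro p
    rw [freeEval, ← Polynomial.aeval_algHom_apply, FreeAlgebra.lift_ι_apply]
  have hrel : ∀ ⦃a b⦄, Rel 1 h φ a b → FreeAlgebra.lift K v a = FreeAlgebra.lift K v b := by
    rintro _ _ (_ | _ | _ | _) <;> simp only [map_mul, hp, FreeAlgebra.lift_ι_apply, v]
    · rw [t.xz, sigma_one_eq_taylor]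
      simp
    · rw [t.yz, sigmaInv_one_eq_taylor]
      simp [sub_eq_add_neg]
    · exact t.yx
    · rw [t.xy, sigma_one_eq_taylor]
  refine ⟨RingQuot.liftAlgHom K ⟨FreeAlgebra.lift K v, hrel⟩, ?_, ?_, ?_⟩
  · exact (RingQuot.liftAlgHom_mkAlgHom_apply K _ hrel _).trans (FreeAlgebra.lift_ι_apply v _)
  · exact (RingQuot.liftAlgHom_mkAlgHom_apply K _ hrel _).trans (FreeAlgebra.lift_ι_apply v _)
  · exact (RingQuot.liftAlgHom_mkAlgHom_apply K _ hrel _).trans (FreeAlgebra.lift_ι_apply v _)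

theorem span_monomial_eq_top :
    Submodule.span K (Set.range (gwaMonomial (x 1 h φ) (y 1 h φ) (z 1 h φ))) = ⊤ :=
  (triple h φ).span_monomial_eq_top (adjoin_eq_top h φ)

/-- A relation among monomials would survive in the shift representation, where there is none. -/
theorem linearIndependent_monomial [CharZero K] {h : K} (hh : h ≠ 0) {φ : K[X]} (hφ : φ ≠ 0) :
    LinearIndependent K (gwaMonomial (x 1 h φ) (y 1 h φ) (z 1 h φ)) := by
  obtain ⟨f, hx, hy, hz⟩ := exists_algHom h φ (ShiftOperator.triple h φ)
  refine LinearIndependent.of_comp f.toLinearMap ?_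
  have hf : f.toLinearMap ∘ gwaMonomial (x 1 h φ) (y 1 h φ) (z 1 h φ) =
      gwaMonomial (ShiftOperator.opX h) (ShiftOperator.opY h φ) ShiftOperator.opZ := by
    funext i
    have := map_gwaMonomial (x 1 h φ) (y 1 h φ) (z 1 h φ) f i
    rwa [hx, hy, hz] at this
  rw [hf]
  exact ShiftOperator.linearIndependent_monomial hh hφ

/-- The basis `z ^ p x_q` of the generalized Weyl algebra. -/
noncomputable def monomialBasis [CharZero K] {h : K} (hh : h ≠ 0) {φ : K[X]} (hφ : φ ≠ 0) :
    Module.Basis (ℕ × ℤ) K (GWA K 1 h φ) :=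
  Module.Basis.mk (linearIndependent_monomial hh hφ) (span_monomial_eq_top h φ).ge

theorem monomialBasis_apply [CharZero K] {h : K} (hh : h ≠ 0) {φ : K[X]} (hφ : φ ≠ 0)
    (i : ℕ × ℤ) :
    monomialBasis hh hφ i = gwaMonomial (x 1 h φ) (y 1 h φ) (z 1 h φ) i := by
  simp [monomialBasis]

end UniversalProperty

end GWA

/-! ### Deformations from algebras over `k[τ]` with a basis -/

namespace BasisDeformation

/-- Unlike span induction this does not ask `p` to be stable under scalars: the maps studied below
are a priori only `k`-linear on a `k[τ]`-module. -/
theorem induction_smul_basis {R M ι : Type*} [CommRing R] [AddCommGroup M] [Module R M]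
    (b : Module.Basis ι R M) {p : M → Prop} (w : M) (h0 : p 0) (hadd : ∀ u v, p u → p v → p (u + v))
    (h : ∀ (r : R) i, p (r • b i)) : p w := by
  have hw : w ∈ Submodule.span R (Set.range b) := by simp [b.span_eq]
  induction hw using Submodule.closure_induction with
  | zero => exact h0
  | add u v _ _ hu hv => exact hadd u v hu hv
  | smul_mem r u hu =>
    obtain ⟨i, rfl⟩ := hu
    exact h r i

variable {k ι A H : Type*} [Field k] [Ring A] [Algebra k A] [Ring H] [Algebra k H]
  [Algebra k[X] H]
  (bA : Module.Basis ι k A) (bH : Module.Basis ι k[X] H)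

/-- The `k`-linear map `A → H` identifying the basis elements. -/
noncomputable def emb : A →ₗ[k] H := bA.constr k bH

@[simp]
theorem emb_basis (i : ι) : emb bA bH (bA i) = bH i := by
  simp [emb]

variable [IsScalarTower k k[X] H]

/-- The coefficient of `τ ^ n`, as a `k`-linear map `H → A`. -/
noncomputable def coeffMap (n : ℕ) : H →ₗ[k] A :=
  Finsupp.linearCombination k bA ∘ₗ Finsupp.mapRange.linearMap (Polynomial.lcoeff k n) ∘ₗ
    (bH.repr : H →ₗ[k[X]] ι →₀ k[X]).restrictScalars k

/-- The cochain sending `(a, b)` to the coefficient of `τ ^ n` in the product of `a` and `b`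
in `H`. -/
noncomputable def cochain (n : ℕ) : Cochain2 k A :=
  ((LinearMap.mul k H).compl₁₂ (emb bA bH) (emb bA bH)).compr₂ (coeffMap bA bH n)

/-- The expansion `H → A[[τ]]`. -/
noncomputable def expand : H →ₗ[k] A⟦X⟧ where
  toFun w := PowerSeries.mk fun n => coeffMap bA bH n w
  map_add' u v := by ext n; simp
  map_smul' r u := by ext n; simp

@[simp]
theorem coeff_expand (n : ℕ) (w : H) :
    PowerSeries.coeff n (expand bA bH w) = coeffMap bA bH n w := by
  simp [expand]

theorem cochain_apply (n : ℕ) (a b : A) :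
    cochain bA bH n a b = coeffMap bA bH n (emb bA bH a * emb bA bH b) := rfl

theorem coeffMap_smul_basis (n : ℕ) (r : k[X]) (i : ι) :
    coeffMap bA bH n (r • bH i) = r.coeff n • bA i := by
  simp [coeffMap]

theorem coeffMap_emb (n : ℕ) (a : A) :
    coeffMap bA bH n (emb bA bH a) = if n = 0 then a else 0 := by
  have h1 : coeffMap bA bH n ∘ₗ emb bA bH = if n = 0 then LinearMap.id else 0 := by
    refine bA.ext fun i => ?_
    have := coeffMap_smul_basis bA bH n 1 i
    rw [one_smul] at this
    rw [LinearMap.comp_apply, emb_basis, this, Polynomial.coeff_one]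
    split_ifs <;> simp
  have := LinearMap.congr_fun h1 a
  rw [LinearMap.comp_apply] at this
  rw [this]
  split_ifs <;> simp

theorem expand_emb (a : A) : expand bA bH (emb bA bH a) = PowerSeries.C a := by
  ext n
  rw [coeff_expand, coeffMap_emb, PowerSeries.coeff_C]

theorem expand_smul (r : k[X]) (w : H) :
    expand bA bH (r • w) = PowerSeries.map (algebraMap k A) r * expand bA bH w := by
  induction w using induction_smul_basis bH with
  | h0 => simp
  | hadd u v hu hv => rw [smul_add, map_add, hu, hv, map_add, mul_add]
  | h s i =>
    ext n
    rw [coeff_expand, smul_smul, coeffMap_smul_basis, coeff_map_algebraMap_mul,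
      Polynomial.coeff_mul, Finset.sum_smul]
    refine Finset.sum_congr rfl fun p _ => ?_
    rw [coeff_expand, coeffMap_smul_basis, Polynomial.coeff_coe, smul_smul]

theorem coeff_starMul_C (F : ℕ → Cochain2 k A) (a b : A) (n : ℕ) :
    PowerSeries.coeff n (starMul F (PowerSeries.C a) (PowerSeries.C b)) = F n a b := by
  rw [coeff_starMul, sum_antidiagonal_eq_of_snd, sum_antidiagonal_eq_of_fst]
  · simp
  · intro i j _
    simp [PowerSeries.coeff_C]
  · intro i j _
    refine Finset.sum_eq_zero fun q hq => ?_
    rw [Finset.HasAntidiagonal.mem_antidiagonal] at hq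
    rcases hq1 : q.1 with _ | m
    · have : q.2 ≠ 0 := by omega
      simp [PowerSeries.coeff_C, this]
    · simp [PowerSeries.coeff_C]

/-- Both sides are additive and `k[τ]`-homogeneous in each factor, so basis elements suffice; there
the identity is the definition of `cochain`. -/
theorem expand_mul (u v : H) :
    expand bA bH (u * v) = starMul (cochain bA bH) (expand bA bH u) (expand bA bH v) := by
  have hzl : ∀ b : A⟦X⟧, starMul (cochain bA bH) 0 b = 0 := fun b => by
    have h := starMul_add_left (cochain bA bH) 0 0 b
    rw [add_zero] at h
    exact left_eq_add.mp h
  have hzr : ∀ b : A⟦X⟧, starMul (cochain bA bH) b 0 = 0 := fun b => by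
    have h := starMul_add_right (cochain bA bH) b 0 0
    rw [add_zero] at h
    exact left_eq_add.mp h
  induction u using induction_smul_basis bH with
  | h0 => rw [zero_mul, map_zero, hzl]
  | hadd u u' hu hu' => rw [add_mul, map_add, hu, hu', map_add, starMul_add_left]
  | h r i =>
    induction v using induction_smul_basis bH with
    | h0 => rw [mul_zero, map_zero, hzr]
    | hadd v v' hv hv' => rw [mul_add, map_add, hv, hv', map_add, starMul_add_right]
    | h s j =>
      rw [smul_mul_smul_comm, mul_smul, expand_smul, expand_smul, expand_smul, expand_smul,
        starMul_smul_left, starMul_smul_right]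
      congr 2
      ext n
      rw [← emb_basis bA bH i, ← emb_basis bA bH j, expand_emb, expand_emb, coeff_starMul_C,
        coeff_expand, cochain_apply]

/-- Density of `H` in `A[[τ]]` for the `τ`-adic topology: the truncation of `a` lifts. -/
theorem exists_expand_coeff_eq (a : A⟦X⟧) (N : ℕ) :
    ∃ w : H, ∀ n ≤ N, PowerSeries.coeff n (expand bA bH w) = PowerSeries.coeff n a := by
  refine ⟨∑ i ∈ Finset.range (N + 1), (Polynomial.X ^ i : k[X]) • emb bA bH
    (PowerSeries.coeff i a), fun n hn => ?_⟩
  rw [map_sum, map_sum, Finset.sum_eq_single n]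
  · rw [expand_smul, expand_emb]
    simp
  · intro i _ hi
    rw [expand_smul, expand_emb]
    simp [PowerSeries.coeff_X_pow, hi.symm]
  · intro h
    exact absurd (Finset.mem_range.2 (by omega)) h

theorem coeff_starMul_congr (F : ℕ → Cochain2 k A) {a a' b b' : A⟦X⟧} {N : ℕ}
    (ha : ∀ n ≤ N, PowerSeries.coeff n a = PowerSeries.coeff n a')
    (hb : ∀ n ≤ N, PowerSeries.coeff n b = PowerSeries.coeff n b') :
    ∀ n ≤ N, PowerSeries.coeff n (starMul F a b) = PowerSeries.coeff n (starMul F a' b') := by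
  intro n hn
  rw [coeff_starMul, coeff_starMul]
  refine Finset.sum_congr rfl fun p hp => Finset.sum_congr rfl fun q hq => ?_
  rw [Finset.HasAntidiagonal.mem_antidiagonal] at hp hq
  rw [ha _ (by omega), hb _ (by omega)]

/-- At order `N` each series may be replaced by the expansion of an element of `H`, where
associativity is known. -/
theorem starMul_assoc (a b c : A⟦X⟧) :
    starMul (cochain bA bH) (starMul (cochain bA bH) a b) c =
      starMul (cochain bA bH) a (starMul (cochain bA bH) b c) := by
  ext N
  obtain ⟨u, hu⟩ := exists_expand_coeff_eq bA bH a N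
  obtain ⟨v, hv⟩ := exists_expand_coeff_eq bA bH b N
  obtain ⟨w, hw⟩ := exists_expand_coeff_eq bA bH c N
  rw [← coeff_starMul_congr _ (coeff_starMul_congr _ hu hv) hw N le_rfl,
    ← coeff_starMul_congr _ hu (coeff_starMul_congr _ hv hw) N le_rfl,
    ← expand_mul, ← expand_mul, ← expand_mul, ← expand_mul, mul_assoc]

/-- The formal deformation of `A` defined by `H`. -/
noncomputable def deformation (h1 : emb bA bH 1 = 1)
    (h0 : ∀ a b, cochain bA bH 0 a b = a * b) : FormalDeformation k A where
  F := cochain bA bH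
  isFormalDeformation :=
    ⟨LinearMap.ext₂ fun a b => by rw [h0, LinearMap.mul_apply'], starMul_assoc bA bH⟩
  unital n hn u := by
    have hn' : n ≠ 0 := by omega
    simp [cochain_apply, h1, coeffMap_emb, hn']

section Expansion

variable (h1 : emb bA bH 1 = 1) (h0 : ∀ a b, cochain bA bH 0 a b = a * b)

/-- The expansion `H → (A[[τ]], *)` as a ring homomorphism. -/
noncomputable def expandHom : H →+* (deformation bA bH h1 h0).Series where
  toFun w := (expand bA bH w : A⟦X⟧)
  map_zero' := map_zero (expand bA bH)
  map_add' := map_add (expand bA bH)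
  map_one' := by
    have := expand_emb bA bH 1
    rw [h1, map_one (PowerSeries.C (R := A))] at this
    exact this
  map_mul' := expand_mul bA bH

theorem expandHom_smul (r : k[X]) (w : H) :
    expandHom bA bH h1 h0 (r • w) = (r : k⟦X⟧) • expandHom bA bH h1 h0 w :=
  expand_smul bA bH r w

theorem expandHom_emb (a : A) :
    expandHom bA bH h1 h0 (emb bA bH a) = (deformation bA bH h1 h0).const a :=
  expand_emb bA bH a

theorem expandHom_mem_tildeSubmodule (w : H) :
    expandHom bA bH h1 h0 w ∈ (deformation bA bH h1 h0).tildeSubmodule := by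
  induction w using induction_smul_basis bH with
  | h0 => rw [map_zero]; exact Submodule.zero_mem _
  | hadd u v hu hv => rw [map_add]; exact Submodule.add_mem _ hu hv
  | h r i =>
    rw [expandHom_smul, ← emb_basis bA bH, expandHom_emb]
    exact Submodule.smul_mem _ _ (Submodule.subset_span ⟨_, rfl⟩)

theorem isLocallyFinite : (deformation bA bH h1 h0).IsLocallyFinite := by
  intro u v
  rw [← expandHom_emb, ← expandHom_emb, ← map_mul]
  exact expandHom_mem_tildeSubmodule bA bH h1 h0 _

end Expansion

end BasisDeformation

/-! ### Bases of `A` as bases of `Ã`. -/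

namespace FormalDeformation

variable {k A ι : Type*} [Field k] [Ring A] [Algebra k A] (D : FormalDeformation k A)

theorem const_add (a b : A) : D.const (a + b) = D.const a + D.const b :=
  map_add (PowerSeries.C (R := A)) a b

theorem const_smul (r : k) (a : A) : D.const (r • a) = (PowerSeries.C r : k⟦X⟧) • D.const a := by
  change (PowerSeries.C (r • a) : A⟦X⟧) = PowerSeries.map (algebraMap k A) (PowerSeries.C r) *
    PowerSeries.C a
  rw [PowerSeries.map_C, ← map_mul, Algebra.smul_def]

/-- The module structure is coefficientwise on constants, so a relation over `k[[τ]]` is a relation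
over `k` in each degree. -/
theorem linearIndependent_const {v : ι → A} (hv : LinearIndependent k v) :
    LinearIndependent k⟦X⟧ (fun i => D.const (v i)) := by
  rw [linearIndependent_iff'] at hv ⊢
  intro s g hg i hi
  ext n
  refine hv s (fun i => PowerSeries.coeff n (g i)) ?_ i hi
  have h1 : PowerSeries.coeff n (∑ i ∈ s, PowerSeries.map (algebraMap k A) (g i) *
      PowerSeries.C (v i)) = 0 := by
    have h2 : ∑ i ∈ s, PowerSeries.map (algebraMap k A) (g i) * PowerSeries.C (v i) = 0 := hg
    rw [h2, map_zero]
  rw [map_sum] at h1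
  rw [← h1]
  refine Finset.sum_congr rfl fun i _ => ?_
  rw [PowerSeries.coeff_mul_C, PowerSeries.coeff_map, Algebra.smul_def]

/-- A basis of `A` is a basis of `Ã = A ⊗ k[[τ]]`. -/
noncomputable def tildeBasis (h : D.IsLocallyFinite) (b : Module.Basis ι k A) :
    Module.Basis ι k⟦X⟧ (D.tilde h) :=
  Module.Basis.mk (v := fun i => D.ofA h (b i))
    (LinearIndependent.of_comp (D.tilde h).val.toLinearMap
      (D.linearIndependent_const b.linearIndependent))
    (by
      have hA : ∀ a : A, D.ofA h a ∈ Submodule.span k⟦X⟧ (Set.range fun i => D.ofA h (b i)) := by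
        intro a
        induction b.mem_span a using Submodule.span_induction with
        | zero =>
          convert Submodule.zero_mem _ using 1
          exact Subtype.ext (map_zero (PowerSeries.C (R := A)))
        | add u v _ _ hu hv =>
          convert Submodule.add_mem _ hu hv using 1
          exact Subtype.ext (D.const_add u v)
        | smul r u _ hu =>
          convert Submodule.smul_mem _ (PowerSeries.C r : k⟦X⟧) hu using 1
          exact Subtype.ext (D.const_smul r u)
        | mem u hu =>
          obtain ⟨i, rfl⟩ := hu
          exact Submodule.subset_span ⟨i, rfl⟩
      rintro ⟨s, hs⟩ -
      have hs' : s ∈ D.tildeSubmodule := hs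
      induction hs' using Submodule.span_induction with
      | zero => exact Submodule.zero_mem _
      | add u v hu hv hu' hv' =>
        exact Submodule.add_mem _ (hu' hu) (hv' hv)
      | smul r u hu hu' => exact Submodule.smul_mem _ r (hu' hu)
      | mem u hu =>
        obtain ⟨a, rfl⟩ := hu
        exact hA a)

theorem tildeBasis_apply (h : D.IsLocallyFinite) (b : Module.Basis ι k A) (i : ι) :
    D.tildeBasis h b i = D.ofA h (b i) := by
  simp [tildeBasis]

end FormalDeformation

/-! ### Uniqueness -/

section Difference

variable {k A : Type*} [Field k] [Ring A] [Algebra k A]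

theorem coeff_starMul_C_right (F : ℕ → Cochain2 k A) (s : A⟦X⟧) (c : A) (n : ℕ) :
    PowerSeries.coeff n (starMul F s (PowerSeries.C c)) =
      ∑ p ∈ Finset.HasAntidiagonal.antidiagonal n, F p.1 (PowerSeries.coeff p.2 s) c := by
  rw [coeff_starMul]
  refine Finset.sum_congr rfl fun p _ => ?_
  rw [sum_antidiagonal_eq_of_snd]
  · simp
  · intro i j _
    simp

theorem coeff_starMul_C_left (F : ℕ → Cochain2 k A) (s : A⟦X⟧) (c : A) (n : ℕ) :
    PowerSeries.coeff n (starMul F (PowerSeries.C c) s) =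
      ∑ p ∈ Finset.HasAntidiagonal.antidiagonal n, F p.1 c (PowerSeries.coeff p.2 s) := by
  rw [coeff_starMul]
  refine Finset.sum_congr rfl fun p _ => ?_
  rw [sum_antidiagonal_eq_of_fst]
  · simp
  · intro i j _
    simp

theorem IsFormalDeformation.sum_assoc {F : ℕ → Cochain2 k A} (hF : IsFormalDeformation F)
    (n : ℕ) (a b c : A) :
    ∑ p ∈ Finset.HasAntidiagonal.antidiagonal n, F p.1 (F p.2 a b) c =
      ∑ p ∈ Finset.HasAntidiagonal.antidiagonal n, F p.1 a (F p.2 b c) := by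
  have h := congrArg (PowerSeries.coeff n)
    (hF.2 (PowerSeries.C a) (PowerSeries.C b) (PowerSeries.C c))
  rw [coeff_starMul_C_right, coeff_starMul_C_left] at h
  simpa only [BasisDeformation.coeff_starMul_C] using h

theorem sum_antidiagonal_ends {M : Type*} [AddCommMonoid M] {n : ℕ} (hn : n ≠ 0)
    (f : ℕ × ℕ → M) (h : ∀ p, p.1 + p.2 = n → p.1 ≠ 0 → p.2 ≠ 0 → f p = 0) :
    ∑ p ∈ Finset.HasAntidiagonal.antidiagonal n, f p = f (0, n) + f (n, 0) := by
  refine Finset.sum_eq_add_of_mem _ _ (by simp) (by simp) (by simp [hn.symm, hn]) ?_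
  rintro ⟨i, j⟩ hij ⟨h1, h2⟩
  rw [Finset.HasAntidiagonal.mem_antidiagonal] at hij
  simp only [Prod.mk.injEq, not_and, ne_eq] at h1 h2
  refine h _ hij ?_ ?_
  · intro hi
    simp only at hi hij
    omega
  · intro hi
    simp only at hi hij
    omega

/-- In the order `n` associativity equations the terms mixing two positive orders cancel; the two
end terms, involving the multiplication, assemble into the coboundary up to sign. -/
theorem IsFormalDeformation.isHochschildCocycle_sub {F F' : ℕ → Cochain2 k A}
    (hF : IsFormalDeformation F) (hF' : IsFormalDeformation F') {n : ℕ} (hn : n ≠ 0)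
    (h : ∀ m < n, F m = F' m) : IsHochschildCocycle (F n - F' n) := by
  intro a b c
  have h1 := hF.sum_assoc n a b c
  have h2 := hF'.sum_assoc n a b c
  have h3 := congrArg₂ (· - ·) h1 h2
  simp only [← Finset.sum_sub_distrib] at h3
  rw [sum_antidiagonal_ends hn, sum_antidiagonal_ends hn] at h3
  · simp only [hF.1, hF'.1, LinearMap.mul_apply'] at h3
    simp only [hochschildB, LinearMap.sub_apply, mul_sub, sub_mul]
    rw [← sub_eq_zero] at h3
    rw [← neg_eq_zero, ← h3]
    abel
  · intro p hp hp1 hp2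
    rw [h p.1 (by omega), h p.2 (by omega), sub_self]
  · intro p hp hp1 hp2
    rw [h p.1 (by omega), h p.2 (by omega), sub_self]

theorem IsHochschildCocycle.sub {F F' : Cochain2 k A} (hF : IsHochschildCocycle F)
    (hF' : IsHochschildCocycle F') : IsHochschildCocycle (F - F') := by
  intro a b c
  have h1 := hF a b c
  have h2 := hF' a b c
  simp only [hochschildB, LinearMap.sub_apply, mul_sub, sub_mul] at *
  rw [← sub_eq_zero.2 (h1.trans h2.symm)]
  abel

theorem IsHochschildCocycle.apply_mul {F : Cochain2 k A} (hF : IsHochschildCocycle F)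
    {a b : A} (ha : F a = 0) (c : A) : F (a * b) c = a * F b c := by
  have h := hF a b c
  simp only [hochschildB, ha, LinearMap.zero_apply, zero_mul, sub_zero, add_zero] at h
  exact (sub_eq_zero.1 h).symm

theorem IsHochschildCocycle.apply_mul_right {F : Cochain2 k A} (hF : IsHochschildCocycle F)
    {a b c : A} (hb : F b c = 0) (hab : F a b = 0) : F a (b * c) = F (a * b) c := by
  have h := hF a b c
  simp only [hochschildB, hb, hab, mul_zero, zero_mul, sub_zero, zero_sub] at h
  rwa [neg_add_eq_zero, eq_comm] at h

/-- By the cocycle identity the `a` with `F a = 0` form a subspace closed under multiplication, and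
`h1` puts the constants in it. -/
theorem IsHochschildCocycle.eq_zero_of_adjoin {F : Cochain2 k A} (hF : IsHochschildCocycle F)
    {s : Set A} (hs : Algebra.adjoin k s = ⊤) (h1 : F 1 = 0) (h : ∀ a ∈ s, F a = 0) : F = 0 := by
  refine LinearMap.ext fun a => ?_
  have ha : a ∈ Algebra.adjoin k s := hs ▸ Algebra.mem_top
  induction ha using Algebra.adjoin_induction with
  | mem a ha => exact h a ha
  | algebraMap r => rw [Algebra.algebraMap_eq_smul_one, map_smul, h1]; simp
  | add a b _ _ ha hb => rw [map_add, ha, hb]; simp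
  | mul a b _ _ ha hb =>
    refine LinearMap.ext fun c => ?_
    rw [hF.apply_mul ha, hb]
    simp

end Difference

/-! ### Uniqueness of `F_1` and of the integrating family. -/

namespace GWA

variable {k : Type*} [Field k] {η : k} {φ : k[X]}

theorem linearMap_eq_zero_of_monomial {M : Type*} [AddCommGroup M] [Module k M]
    (f : GWA k 1 η φ →ₗ[k] M)
    (h : ∀ (i : ℕ) (q : ℤ), f (z 1 η φ ^ i * xi 1 η φ q) = 0) : f = 0 := by
  refine LinearMap.ext_on_range (span_monomial_eq_top η φ) fun i => ?_
  exact h i.1 i.2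

theorem xi_cases {p : ℤ → Prop} (hx : ∀ j : ℕ, p j) (hy : ∀ j : ℕ, p (-((j + 1 : ℕ) : ℤ)))
    (q : ℤ) : p q := by
  rcases le_or_gt 0 q with hq | hq
  · lift q to ℕ using hq
    exact hx q
  · obtain ⟨n, rfl⟩ : ∃ n : ℕ, q = -((n + 1 : ℕ) : ℤ) := ⟨(-q - 1).toNat, by omega⟩
    exact hy n

theorem xi_natCast (n : ℕ) : xi 1 η φ n = x 1 η φ ^ n := gwaXi_natCast _ _ n

theorem xi_neg_natCast (n : ℕ) : xi 1 η φ (-n) = y 1 η φ ^ n := gwaXi_neg_natCast _ _ n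

/-- The listed pairs contain every generator in the first slot against every monomial in the second,
which determines a cocycle. -/
theorem CorrespondsTo.unique {F F' : Cochain2 k (GWA k 1 η φ)}
    {c : GWA k 1 η φ × GWA k 1 η φ × GWA k 1 η φ × GWA k 1 η φ}
    (hF : CorrespondsTo F c) (hF' : CorrespondsTo F' c) : F = F' := by
  rw [← sub_eq_zero]
  have hz : ∀ p : ℕ, (F - F') (z 1 η φ ^ p) = 0 := fun p =>
    linearMap_eq_zero_of_monomial _ fun i q => by
      rw [LinearMap.sub_apply, LinearMap.sub_apply, hF.z_left, hF'.z_left, sub_self]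
  refine (hF.cocycle.sub hF'.cocycle).eq_zero_of_adjoin (adjoin_eq_top η φ)
    (by simpa using hz 0) ?_
  rintro _ (rfl | rfl | rfl)
  · refine linearMap_eq_zero_of_monomial _ fun i q => ?_
    induction q using xi_cases with
    | hx j =>
      have h1 := hF.xx 0 1 i j
      have h2 := hF'.xx 0 1 i j
      rw [pow_zero, one_mul, pow_one, ← xi_natCast] at h1 h2
      rw [LinearMap.sub_apply, LinearMap.sub_apply, h1, h2, sub_self]
    | hy j =>
      have h1 := hF.xy 0 i j
      have h2 := hF'.xy 0 i j
      rw [pow_zero, one_mul, ← xi_neg_natCast] at h1 h2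
      rw [LinearMap.sub_apply, LinearMap.sub_apply, h1, h2, sub_self]
  · refine linearMap_eq_zero_of_monomial _ fun i q => ?_
    -- The sign is reversed so that the case split gives `y ^ j` with `j ≥ 0` and `x ^ (j + 1)`,
    -- matching `yy` and `yx`.
    obtain ⟨q, rfl⟩ : ∃ q', q = -q' := ⟨-q, by simp⟩
    induction q using xi_cases with
    | hx j =>
      have h1 := hF.yy 0 1 i j
      have h2 := hF'.yy 0 1 i j
      rw [pow_zero, one_mul, pow_one, ← xi_neg_natCast] at h1 h2
      rw [LinearMap.sub_apply, LinearMap.sub_apply, h1, h2, sub_self]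
    | hy j =>
      have h1 := hF.yx 0 i j
      have h2 := hF'.yx 0 i j
      rw [pow_zero, one_mul, ← xi_natCast] at h1 h2
      rw [neg_neg, LinearMap.sub_apply, LinearMap.sub_apply, h1, h2, sub_self]
  · simpa using hz 1

theorem map_ofPoly_mul {F : Cochain2 k (GWA k 1 η φ)}
    (hz : ∀ u v, F (z 1 η φ * u) v = z 1 η φ * F u v) (p : k[X]) (u v : GWA k 1 η φ) :
    F (ofPoly 1 η φ p * u) v = ofPoly 1 η φ p * F u v := by
  induction p using Polynomial.induction_on' generalizing u with
  | add p q hp hq => simp only [map_add, add_mul, LinearMap.add_apply, hp, hq]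
  | monomial n a =>
    have hpow : ∀ u, F (z 1 η φ ^ n * u) v = z 1 η φ ^ n * F u v := by
      induction n with
      | zero => simp
      | succ n ih => intro u; rw [pow_succ, mul_assoc, ih, hz, mul_assoc]
    simp only [ofPoly, Polynomial.aeval_monomial, ← Algebra.smul_def, smul_mul_assoc, map_smul,
      LinearMap.smul_apply, hpow]

/-- For `u = x` or `y`, `G(u, z w) = G(u z, w) = (z + r) G(u, w)` with `r = ±η`, so only `w = x_q`
matters. Equal signs are covered by (b); for opposite signs `G(x, y ^ (j + 1)) = G(x y, y ^ j)`, and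
`x y` is a polynomial in `z`, on which `G` vanishes by (a) and (b). -/
theorem cocycle_eq_zero {G : Cochain2 k (GWA k 1 η φ)} (hG : IsHochschildCocycle G)
    (hA : ConditionA G) (hB : ConditionB G)
    (hxz : G (x 1 η φ) (z 1 η φ) = 0) (hyz : G (y 1 η φ) (z 1 η φ) = 0)
    (hxy : G (x 1 η φ) (y 1 η φ) = 0) (hyx : G (y 1 η φ) (x 1 η φ) = 0) : G = 0 := by
  have hp : ∀ (p : k[X]) v, G (ofPoly 1 η φ p) v = 0 := by
    intro p v
    have := map_ofPoly_mul hB.1 p 1 v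
    rwa [mul_one, (hA v).2, mul_zero] at this
  have hz : G (z 1 η φ) = 0 := LinearMap.ext fun v => by
    simpa [ofPoly] using hp Polynomial.X v
  have key : ∀ (u : GWA k 1 η φ) (r : k), G u (z 1 η φ) = 0 →
      u * z 1 η φ = (z 1 η φ + algebraMap k _ r) * u →
      (∀ q, G u (xi 1 η φ q) = 0) → G u = 0 := by
    intro u r huz hcomm hq
    refine linearMap_eq_zero_of_monomial _ fun i q => ?_
    induction i with
    | zero => simpa using hq q
    | succ i ih =>
      have e : z 1 η φ + algebraMap k _ r = ofPoly 1 η φ (Polynomial.X + Polynomial.C r) := by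
        simp [ofPoly]
      rw [pow_succ', mul_assoc, hG.apply_mul_right (by rw [hz]; rfl) huz, hcomm, e,
        map_ofPoly_mul hB.1, ih, mul_zero]
  have t := triple η φ
  refine hG.eq_zero_of_adjoin (adjoin_eq_top η φ) (LinearMap.ext fun v => (hA v).2) ?_
  rintro _ (rfl | rfl | rfl)
  · refine key _ η hxz t.xz fun q => ?_
    induction q using xi_cases with
    | hx j => rw [xi_natCast]; simpa using (hB.2 1 j).1
    | hy j =>
      rw [xi_neg_natCast, pow_succ', hG.apply_mul_right (by simpa using (hB.2 1 j).2) hxy, t.xy]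
      exact hp _ _
  · refine key _ (-η) hyz (by rw [t.yz, map_neg, sub_eq_add_neg]) fun q => ?_
    obtain ⟨q, rfl⟩ : ∃ q', q = -q' := ⟨-q, by simp⟩
    induction q using xi_cases with
    | hx j => rw [xi_neg_natCast]; simpa using (hB.2 1 j).2
    | hy j =>
      rw [neg_neg, xi_natCast, pow_succ',
        hG.apply_mul_right (by simpa using (hB.2 1 j).1) hyx, t.yx]
      exact hp _ _
  · exact hz

theorem integrating_family_unique {F F' : ℕ → Cochain2 k (GWA k 1 η φ)}
    {F₁ : Cochain2 k (GWA k 1 η φ)} (hF : Integrates F₁ F) (hF' : Integrates F₁ F')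
    (h : ∀ n, 2 ≤ n → ConditionA (F n) ∧ ConditionB (F n) ∧ HasClassicalValues n (F n))
    (h' : ∀ n, 2 ≤ n → ConditionA (F' n) ∧ ConditionB (F' n) ∧ HasClassicalValues n (F' n)) :
    F = F' := by
  funext n
  induction n using Nat.strong_induction_on with
  | _ n ih =>
    rcases lt_or_ge n 2 with hn | hn
    · interval_cases n
      · rw [hF.2.1, hF'.2.1]
      · rw [hF.1, hF'.1]
    · obtain ⟨hA, hB, hxz, hyz, hxy, hyx⟩ := h n hn
      obtain ⟨hA', hB', hxz', hyz', hxy', hyx'⟩ := h' n hn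
      rw [← sub_eq_zero]
      refine cocycle_eq_zero (hF.2.isHochschildCocycle_sub hF'.2 (by omega) ih) ?_ ⟨?_, ?_⟩
        ?_ ?_ ?_ ?_
      · intro u
        simp [(hA u).1, (hA u).2, (hA' u).1, (hA' u).2]
      · intro u v
        simp [hB.1, hB'.1, mul_sub]
      · intro q j
        simp [(hB.2 q j).1, (hB.2 q j).2, (hB'.2 q j).1, (hB'.2 q j).2]
      · simp [hxz, hxz']
      · simp [hyz, hyz']
      · simp [hxy, hxy']
      · simp [hyx, hyx']

end GWA

/-! ### The algebra of shift operators as a free module on the monomials. -/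

theorem GWATriple.of_injective {R B B' : Type*} [CommRing R] [Ring B] [Algebra R B] [Ring B']
    [Algebra R B'] {h : R} {φ : R[X]} {x y z : B} (f : B →ₐ[R] B') (hf : Function.Injective f)
    (t : GWATriple h φ (f x) (f y) (f z)) : GWATriple h φ x y z := by
  refine ⟨hf ?_, hf ?_, hf ?_, hf ?_⟩
  · simpa using t.xz
  · simpa using t.yz
  · rw [map_mul, t.yx, Polynomial.aeval_algHom_apply]
  · rw [map_mul, t.xy, Polynomial.aeval_algHom_apply]

namespace ShiftOperator

section ShiftAlgebra

variable {R : Type*} [CommRing R] (h : R) (φ : R[X])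

/-- The generators of the algebra of shift operators. -/
def generators : Set (Module.End R R[X]) := {opX h, opY h φ, opZ}

/-- The algebra generated by the operators `x, y, z` on `R[z]`. -/
def ShiftAlgebra : Type _ := Algebra.adjoin R (generators h φ)

noncomputable instance : Ring (ShiftAlgebra h φ) :=
  inferInstanceAs (Ring (Algebra.adjoin R (generators h φ)))

noncomputable instance : Algebra R (ShiftAlgebra h φ) :=
  inferInstanceAs (Algebra R (Algebra.adjoin R (generators h φ)))

/-- From here on the inner variable of `k[X][X]` plays the role of `τ` and the outer one that of
`z`. -/
noncomputable instance {k : Type*} [Field k] (h : k[X]) (φ : k[X][X]) :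
    Algebra k (ShiftAlgebra h φ) :=
  Algebra.compHom _ (algebraMap k k[X])

instance {k : Type*} [Field k] (h : k[X]) (φ : k[X][X]) :
    IsScalarTower k k[X] (ShiftAlgebra h φ) :=
  IsScalarTower.of_algebraMap_eq fun _ => rfl

/-- The inclusion into the algebra of all operators. -/
noncomputable def incl : ShiftAlgebra h φ →ₐ[R] Module.End R R[X] :=
  (Algebra.adjoin R (generators h φ)).val

theorem incl_injective : Function.Injective (incl h φ) := Subtype.val_injective

/-- The generator `x`. -/
noncomputable def genX : ShiftAlgebra h φ := ⟨opX h, Algebra.subset_adjoin (Or.inl rfl)⟩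

/-- The generator `y`. -/
noncomputable def genY : ShiftAlgebra h φ :=
  ⟨opY h φ, Algebra.subset_adjoin (Or.inr (Or.inl rfl))⟩

/-- The generator `z`. -/
noncomputable def genZ : ShiftAlgebra h φ :=
  ⟨opZ, Algebra.subset_adjoin (Or.inr (Or.inr rfl))⟩

theorem gen_triple : GWATriple h φ (genX h φ) (genY h φ) (genZ h φ) :=
  GWATriple.of_injective (incl h φ) (incl_injective h φ) (triple h φ)

theorem adjoin_gen : Algebra.adjoin R {genX h φ, genY h φ, genZ h φ} = ⊤ := by
  refine Eq.trans ?_ (Algebra.adjoin_adjoin_coe_preimage (R := R) (s := generators h φ))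
  refine congrArg (Algebra.adjoin R (A := ShiftAlgebra h φ)) ?_
  ext a
  constructor
  · rintro (rfl | rfl | rfl)
    exacts [Or.inl rfl, Or.inr (Or.inl rfl), Or.inr (Or.inr rfl)]
  · rintro (h | h | h)
    exacts [Or.inl (Subtype.ext h), Or.inr (Or.inl (Subtype.ext h)),
      Or.inr (Or.inr (Subtype.ext h))]

variable {h φ}

theorem linearIndependent_gen_monomial [IsDomain R] [CharZero R] (hh : h ≠ 0) (hφ : φ ≠ 0) :
    LinearIndependent R (gwaMonomial (genX h φ) (genY h φ) (genZ h φ)) := by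
  refine LinearIndependent.of_comp (incl h φ).toLinearMap ?_
  have hf : (incl h φ).toLinearMap ∘
      gwaMonomial (genX h φ) (genY h φ) (genZ h φ) = gwaMonomial (opX h) (opY h φ) opZ :=
    funext fun i => map_gwaMonomial _ _ _ (incl h φ) i
  rw [hf]
  exact linearIndependent_monomial hh hφ

/-- The basis `z ^ p x_q` of the algebra of shift operators. -/
noncomputable def basis [IsDomain R] [CharZero R] (hh : h ≠ 0) (hφ : φ ≠ 0) :
    Module.Basis (ℕ × ℤ) R (ShiftAlgebra h φ) :=
  Module.Basis.mk (linearIndependent_gen_monomial hh hφ)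
    ((gen_triple h φ).span_monomial_eq_top (adjoin_gen h φ)).ge

theorem basis_apply [IsDomain R] [CharZero R] (hh : h ≠ 0) (hφ : φ ≠ 0) (i : ℕ × ℤ) :
    basis hh hφ i = gwaMonomial (genX h φ) (genY h φ) (genZ h φ) i := by
  simp [basis]

end ShiftAlgebra

end ShiftOperator

/-! ### Coefficients of polynomials over `k[τ]` -/

section TauCoeff

variable {k : Type*} [Field k]

/-- The coefficient of `τ ^ n` of a polynomial in `z` over `k[τ]`. -/
noncomputable def tauCoeff (n : ℕ) : k[X][X] →ₗ[k] k[X] :=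
  (Polynomial.lcoeff k[X] n).restrictScalars k ∘ₗ
    (Polynomial.Bivariate.swap (R := k)).toLinearMap

theorem tauCoeff_apply (n : ℕ) (p : k[X][X]) :
    tauCoeff n p = (Polynomial.Bivariate.swap p).coeff n := rfl

theorem tauCoeff_map_mul (n : ℕ) (f : k[X]) (p : k[X][X]) :
    tauCoeff n (f.map Polynomial.C * p) = f * tauCoeff n p := by
  rw [tauCoeff_apply, map_mul, Polynomial.Bivariate.swap_map_C, Polynomial.coeff_C_mul,
    tauCoeff_apply]

/-- The constant coefficient in `τ` is specialization at `τ = 0`, a ring homomorphism; hence it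
respects products and shifts. -/
theorem tauCoeff_zero_eq_map (p : k[X][X]) :
    tauCoeff 0 p = p.map Polynomial.constantCoeff := by
  have h : ((Polynomial.constantCoeff (R := k[X])).comp
      ((Polynomial.Bivariate.swap (R := k)).toRingEquiv.toRingHom)) =
      Polynomial.mapRingHom Polynomial.constantCoeff := by
    ext <;> simp [Polynomial.Bivariate.swap_X, Polynomial.Bivariate.swap_Y,
      Polynomial.Bivariate.swap_C_C]
  exact RingHom.congr_fun h p

theorem map_taylor {S S' : Type*} [CommRing S] [CommRing S'] (f : S →+* S') (r : S) (p : S[X]) :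
    (Polynomial.taylor r p).map f = Polynomial.taylor (f r) (p.map f) := by
  simp [Polynomial.taylor_apply, Polynomial.map_comp]

/-- Taylor's formula: `f(z + a + cτ)` is the sum of `c ^ n τ ^ n` times the `n`-th Hasse derivative
of `f` at `z + a`. -/
theorem tauCoeff_taylor (n : ℕ) (a c : k) (f : k[X]) :
    tauCoeff n (Polynomial.taylor (Polynomial.C a + Polynomial.C c * Polynomial.X)
      (f.map Polynomial.C)) = c ^ n • Polynomial.hasseDeriv n (Polynomial.taylor a f) := by
  rw [add_comm (Polynomial.C a), ← Polynomial.taylor_taylor, ← map_taylor]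
  generalize Polynomial.taylor a f = g
  -- With `g(z) = f(z + a)`, exchanging variables turns `g(z + cτ)` into a polynomial whose outer
  -- variable is `τ`: it is `g(z + τ)` with `τ` scaled by `c`. As these are algebra maps in `g`, the
  -- variable is enough.
  have h : ((Polynomial.Bivariate.swap (R := k) : k[X][X] →ₐ[k] k[X][X]).comp
      (((Polynomial.taylorAlgHom (Polynomial.C c * Polynomial.X : k[X])).restrictScalars k).comp
        (Polynomial.mapAlgHom (Algebra.ofId k k[X])))) =
      ((Polynomial.aeval (Polynomial.C (Polynomial.C c) * Polynomial.X : k[X][X]) :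
        k[X][X] →ₐ[k[X]] k[X][X]).restrictScalars k).comp
      (((Polynomial.taylorAlgHom (Polynomial.X : k[X])).restrictScalars k).comp
        (Polynomial.mapAlgHom (Algebra.ofId k k[X]))) := by
    ext1
    simp [Polynomial.Bivariate.swap_X, Polynomial.Bivariate.swap_Y, Polynomial.Bivariate.swap_C_C]
    ring
  have h' := AlgHom.congr_fun h g
  have e : Polynomial.Bivariate.swap (Polynomial.taylor (Polynomial.C c * Polynomial.X)
      (g.map Polynomial.C)) = (Polynomial.taylor Polynomial.X (g.map Polynomial.C)).comp
        (Polynomial.C (Polynomial.C c) * Polynomial.X) := h'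
  rw [tauCoeff_apply, e, Polynomial.comp_C_mul_X_coeff, Polynomial.taylor_coeff]
  have e2 : Polynomial.hasseDeriv n (g.map Polynomial.C) =
      (Polynomial.hasseDeriv n g).map (Polynomial.C (R := k)) := by
    ext1 m
    simp [Polynomial.hasseDeriv_coeff]
  rw [e2, Polynomial.eval_map, Polynomial.eval₂_C_X, ← Polynomial.C_pow, mul_comm,
    Polynomial.smul_eq_C_mul]

end TauCoeff

/-! ### The deformation of the generalized Weyl algebra -/

namespace GWA

open BasisDeformation ShiftOperator

/-- The parameter `η - τ` of the deformed algebra. -/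
noncomputable def tauShift {k : Type*} [Field k] (η : k) : k[X] := Polynomial.C η - Polynomial.X

theorem tauShift_ne_zero {k : Type*} [Field k] (η : k) : tauShift η ≠ 0 := by
  intro h
  have := congrArg (fun p => Polynomial.coeff p 1) h
  simp [tauShift] at this

theorem natCast_mul_tauShift {k : Type*} [Field k] (η : k) (q : ℕ) :
    (q : k[X]) * tauShift η = Polynomial.C (q * η) + Polynomial.C (-(q : k)) * Polynomial.X := by
  simp [tauShift]
  ring

theorem neg_natCast_mul_tauShift {k : Type*} [Field k] (η : k) (q : ℕ) :
    -((q : k[X]) * tauShift η) = Polynomial.C (-(q * η)) + Polynomial.C (q : k) * Polynomial.X := by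
  simp [tauShift]
  ring

theorem map_C_ne_zero {k : Type*} [Field k] {φ : k[X]} (hφ : φ ≠ 0) :
    φ.map (Polynomial.C (R := k)) ≠ 0 :=
  (Polynomial.map_ne_zero_iff Polynomial.C_injective).2 hφ

/-- The generalized Weyl algebra with parameter `η - τ` over `k[τ]`, as an algebra of shift
operators. -/
abbrev Deformed {k : Type*} [Field k] (η : k) (φ : k[X]) : Type _ :=
  ShiftAlgebra (tauShift η) (φ.map (Polynomial.C (R := k)))

/-- The generator `x` of the deformed algebra. -/
noncomputable abbrev dX {k : Type*} [Field k] (η : k) (φ : k[X]) : Deformed η φ := genX _ _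

/-- The generator `y` of the deformed algebra. -/
noncomputable abbrev dY {k : Type*} [Field k] (η : k) (φ : k[X]) : Deformed η φ := genY _ _

/-- The generator `z` of the deformed algebra. -/
noncomputable abbrev dZ {k : Type*} [Field k] (η : k) (φ : k[X]) : Deformed η φ := genZ _ _

theorem deformed_triple {k : Type*} [Field k] (η : k) (φ : k[X]) :
    GWATriple (tauShift η) (φ.map (Polynomial.C (R := k))) (dX η φ) (dY η φ) (dZ η φ) :=
  gen_triple _ _

theorem constantCoeff_tauShift {k : Type*} [Field k] (η : k) :
    Polynomial.constantCoeff (tauShift η) = η := by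
  simp [tauShift]

theorem map_constantCoeff_map_C {k : Type*} [Field k] (f : k[X]) :
    (f.map (Polynomial.C (R := k))).map Polynomial.constantCoeff = f := by
  rw [Polynomial.map_map]
  convert Polynomial.map_id
  ext
  simp

variable {k : Type*} [Field k] [CharZero k] {η : k} (hη : η ≠ 0) {φ : k[X]} (hφ : φ ≠ 0)

/-- The basis of the deformed algebra over `k[τ]`. -/
noncomputable def deformedBasis (η : k) {φ : k[X]} (hφ : φ ≠ 0) :
    Module.Basis (ℕ × ℤ) k[X] (Deformed η φ) :=
  ShiftOperator.basis (tauShift_ne_zero η) (map_C_ne_zero hφ)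

/-- The embedding of the generalized Weyl algebra into the deformed algebra. -/
noncomputable def embD : GWA k 1 η φ →ₗ[k] Deformed η φ :=
  emb (monomialBasis hη hφ) (deformedBasis η hφ)

/-- The coefficient of `τ ^ n` of an element of the deformed algebra. -/
noncomputable def coeffD (n : ℕ) : Deformed η φ →ₗ[k] GWA k 1 η φ :=
  coeffMap (monomialBasis hη hφ) (deformedBasis η hφ) n

/-- The structure maps of the deformation. -/
noncomputable def structureMap (n : ℕ) : Cochain2 k (GWA k 1 η φ) :=
  cochain (monomialBasis hη hφ) (deformedBasis η hφ) n

theorem structureMap_apply (n : ℕ) (a b : GWA k 1 η φ) :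
    structureMap hη hφ n a b = coeffD hη hφ n (embD hη hφ a * embD hη hφ b) := rfl

theorem embD_monomial (i : ℕ × ℤ) :
    embD hη hφ (gwaMonomial (x 1 η φ) (y 1 η φ) (z 1 η φ) i) =
      gwaMonomial (dX η φ) (dY η φ) (dZ η φ) i := by
  rw [← monomialBasis_apply hη hφ, embD, emb_basis, deformedBasis, basis_apply]

theorem coeffD_smul_monomial (n : ℕ) (r : k[X]) (i : ℕ × ℤ) :
    coeffD hη hφ n (r • gwaMonomial (dX η φ) (dY η φ) (dZ η φ) i) =
      r.coeff n • gwaMonomial (x 1 η φ) (y 1 η φ) (z 1 η φ) i := by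
  rw [← monomialBasis_apply hη hφ, ← coeffMap_smul_basis _ (deformedBasis η hφ), deformedBasis,
    basis_apply]
  rfl

theorem embD_ofPoly_mul_xi (f : k[X]) (q : ℤ) :
    embD hη hφ (ofPoly 1 η φ f * xi 1 η φ q) =
      Polynomial.aeval (dZ η φ) (f.map (Polynomial.C (R := k))) * gwaXi (dX η φ) (dY η φ) q := by
  induction f using Polynomial.induction_on' with
  | add p q hp hq => simp only [map_add, add_mul, hp, hq, Polynomial.map_add]
  | monomial n a =>
    have h := embD_monomial hη hφ (n, q)
    rw [ofPoly, Polynomial.aeval_monomial, Polynomial.map_monomial, Polynomial.aeval_monomial,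
      ← Algebra.smul_def, ← Algebra.smul_def, smul_mul_assoc, smul_mul_assoc, map_smul]
    refine (congrArg (a • ·) h).trans ?_
    rw [← one_smul k[X] (gwaMonomial (dX η φ) (dY η φ) (dZ η φ) (n, q)), ← smul_assoc,
      Polynomial.smul_eq_C_mul, mul_one]
    rfl

/-- Together with `embD_ofPoly_mul_xi` this is the dictionary between `A` and `H`: once a product is
written with `z` on the left, coefficients are taken in the polynomial factor alone. -/
theorem coeffD_aeval_mul_xi (n : ℕ) (p : k[X][X]) (q : ℤ) :
    coeffD hη hφ n (Polynomial.aeval (dZ η φ) p * gwaXi (dX η φ) (dY η φ) q) =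
      ofPoly 1 η φ (tauCoeff n p) * xi 1 η φ q := by
  induction p using Polynomial.induction_on' with
  | add p q hp hq => simp only [map_add, add_mul, hp, hq]
  | monomial m r =>
    have h := coeffD_smul_monomial hη hφ n r (m, q)
    rw [Polynomial.aeval_monomial, ← Algebra.smul_def, smul_mul_assoc]
    refine h.trans ?_
    rw [tauCoeff_apply, Polynomial.Bivariate.swap_monomial, Polynomial.coeff_mul_C,
      Polynomial.coeff_map, ← Polynomial.smul_eq_C_mul, map_smul, smul_mul_assoc]
    simp [ofPoly, gwaMonomial]
    rfl

theorem embD_one : embD hη hφ 1 = 1 := by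
  have h := embD_monomial hη hφ (0, 0)
  simpa [gwaMonomial, gwaXi_zero] using h

theorem deformed_induction (hφ : φ ≠ 0) {p : Deformed η φ → Prop} (w : Deformed η φ) (h0 : p 0)
    (hadd : ∀ u v, p u → p v → p (u + v))
    (h : ∀ (f : k[X][X]) q,
      p (Polynomial.aeval (dZ η φ) f * gwaXi (dX η φ) (dY η φ) q)) : p w := by
  refine induction_smul_basis (deformedBasis η hφ) w h0 hadd fun r i => ?_
  have := h (Polynomial.monomial i.1 r) i.2
  rw [Polynomial.aeval_monomial, ← Algebra.smul_def, smul_mul_assoc] at this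
  rw [deformedBasis, basis_apply]
  exact this

/-- Setting `τ = 0` turns the shift `η - τ` into `η` and leaves `φ` unchanged, so the
normal-ordering rules of `H` become those of `A`. -/
theorem coeffD_zero_dX_mul (w : Deformed η φ) :
    coeffD hη hφ 0 (dX η φ * w) = x 1 η φ * coeffD hη hφ 0 w := by
  have t := deformed_triple η φ
  have t' := triple η φ
  induction w using deformed_induction hφ with
  | h0 => simp
  | hadd u v hu hv => rw [mul_add, map_add, hu, hv, map_add, mul_add]
  | h f q =>
    rw [← mul_assoc, t.x_mul_aeval, mul_assoc, coeffD_aeval_mul_xi, ← mul_assoc (x 1 η φ), ofPoly,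
      t'.x_mul_aeval, mul_assoc _ (x 1 η φ)]
    rcases le_or_gt 0 q with hq | hq
    · rw [GWATriple.x_mul_xi_of_nonneg hq, coeffD_aeval_mul_xi, tauCoeff_zero_eq_map, map_taylor,
        constantCoeff_tauShift, ← tauCoeff_zero_eq_map]
      exact congrArg _ (GWATriple.x_mul_xi_of_nonneg hq).symm
    · rw [t.x_mul_xi_of_neg hq, ← mul_assoc, ← map_mul, coeffD_aeval_mul_xi,
        tauCoeff_zero_eq_map, Polynomial.map_mul, map_taylor, map_taylor, constantCoeff_tauShift,
        map_constantCoeff_map_C, ← tauCoeff_zero_eq_map, ofPoly, map_mul, mul_assoc]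
      exact congrArg _ (t'.x_mul_xi_of_neg hq).symm

theorem coeffD_zero_dY_mul (w : Deformed η φ) :
    coeffD hη hφ 0 (dY η φ * w) = y 1 η φ * coeffD hη hφ 0 w := by
  have t := deformed_triple η φ
  have t' := triple η φ
  induction w using deformed_induction hφ with
  | h0 => simp
  | hadd u v hu hv => rw [mul_add, map_add, hu, hv, map_add, mul_add]
  | h f q =>
    rw [← mul_assoc, t.y_mul_aeval, mul_assoc, coeffD_aeval_mul_xi, ← mul_assoc (y 1 η φ), ofPoly,
      t'.y_mul_aeval, mul_assoc _ (y 1 η φ)]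
    rcases le_or_gt q 0 with hq | hq
    · rw [GWATriple.y_mul_xi_of_nonpos hq, coeffD_aeval_mul_xi, tauCoeff_zero_eq_map, map_taylor,
        map_neg, constantCoeff_tauShift, ← tauCoeff_zero_eq_map]
      exact congrArg _ (GWATriple.y_mul_xi_of_nonpos hq).symm
    · rw [t.y_mul_xi_of_pos hq, ← mul_assoc, ← map_mul, coeffD_aeval_mul_xi,
        tauCoeff_zero_eq_map, Polynomial.map_mul, map_taylor, map_neg, constantCoeff_tauShift,
        map_constantCoeff_map_C, ← tauCoeff_zero_eq_map, ofPoly, map_mul, mul_assoc]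
      exact congrArg _ (t'.y_mul_xi_of_pos hq).symm

/-- Valid for every `n`, since left multiplication by `z` involves no `τ`. It is the source of the
first half of (b). -/
theorem coeffD_dZ_mul (n : ℕ) (w : Deformed η φ) :
    coeffD hη hφ n (dZ η φ * w) = z 1 η φ * coeffD hη hφ n w := by
  induction w using deformed_induction hφ with
  | h0 => simp
  | hadd u v hu hv => rw [mul_add, map_add, hu, hv, map_add, mul_add]
  | h f q =>
    have e : dZ η φ * Polynomial.aeval (dZ η φ) f = Polynomial.aeval (dZ η φ)
        ((Polynomial.X : k[X]).map Polynomial.C * f) := by simp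
    rw [← mul_assoc, e, coeffD_aeval_mul_xi, tauCoeff_map_mul, map_mul, coeffD_aeval_mul_xi,
      mul_assoc]
    simp [ofPoly]

theorem coeffD_zero_monomial_mul (i : ℕ × ℤ) (w : Deformed η φ) :
    coeffD hη hφ 0 (gwaMonomial (dX η φ) (dY η φ) (dZ η φ) i * w) =
      gwaMonomial (x 1 η φ) (y 1 η φ) (z 1 η φ) i * coeffD hη hφ 0 w := by
  have hpow : ∀ (a : Deformed η φ) (b : GWA k 1 η φ),
      (∀ w, coeffD hη hφ 0 (a * w) = b * coeffD hη hφ 0 w) → ∀ (n : ℕ) w,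
      coeffD hη hφ 0 (a ^ n * w) = b ^ n * coeffD hη hφ 0 w := by
    intro a b hab n
    induction n with
    | zero => simp
    | succ n ih => intro w; rw [pow_succ', mul_assoc, hab, ih, pow_succ', mul_assoc]
  rw [gwaMonomial, gwaMonomial, mul_assoc, hpow _ _ (coeffD_dZ_mul hη hφ 0), mul_assoc]
  congr 1
  unfold gwaXi
  split_ifs
  · exact hpow _ _ (coeffD_zero_dX_mul hη hφ) _ _
  · exact hpow _ _ (coeffD_zero_dY_mul hη hφ) _ _

theorem structureMap_zero (a b : GWA k 1 η φ) : structureMap hη hφ 0 a b = a * b := by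
  have h : structureMap hη hφ 0 = LinearMap.mul k _ := by
    refine (monomialBasis hη hφ).ext fun i => LinearMap.ext fun b => ?_
    rw [monomialBasis_apply, structureMap_apply, embD_monomial, coeffD_zero_monomial_mul, coeffD,
      embD, coeffMap_emb, if_pos rfl, LinearMap.mul_apply']
  rw [h, LinearMap.mul_apply']

/-- The deformation of the generalized Weyl algebra with parameter `η - τ`. -/
noncomputable def deformation : FormalDeformation k (GWA k 1 η φ) :=
  BasisDeformation.deformation (monomialBasis hη hφ) (deformedBasis η hφ) (embD_one hη hφ)
    (structureMap_zero hη hφ)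

theorem deformation_F (n : ℕ) : (deformation hη hφ).F n = structureMap hη hφ n := rfl

/-! ### Values of the structure maps -/

theorem embD_dZ_mul (u : GWA k 1 η φ) :
    embD hη hφ (z 1 η φ * u) = dZ η φ * embD hη hφ u := by
  have h : embD hη hφ ∘ₗ LinearMap.mulLeft k (z 1 η φ) =
      LinearMap.mulLeft k (dZ η φ) ∘ₗ embD hη hφ := by
    refine (monomialBasis hη hφ).ext fun i => ?_
    have e : z 1 η φ * gwaMonomial (x 1 η φ) (y 1 η φ) (z 1 η φ) i =
        gwaMonomial (x 1 η φ) (y 1 η φ) (z 1 η φ) (i.1 + 1, i.2) := by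
      simp [gwaMonomial, pow_succ', mul_assoc]
    rw [monomialBasis_apply, LinearMap.comp_apply, LinearMap.comp_apply, LinearMap.mulLeft_apply,
      LinearMap.mulLeft_apply, e, embD_monomial, embD_monomial]
    simp [gwaMonomial, pow_succ', mul_assoc]
  exact LinearMap.congr_fun h u

theorem structureMap_z_mul (n : ℕ) (u v : GWA k 1 η φ) :
    structureMap hη hφ n (z 1 η φ * u) v = z 1 η φ * structureMap hη hφ n u v := by
  rw [structureMap_apply, embD_dZ_mul, mul_assoc, coeffD_dZ_mul, structureMap_apply]

theorem embD_ofPoly_mul_x_pow (f : k[X]) (j : ℕ) :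
    embD hη hφ (ofPoly 1 η φ f * x 1 η φ ^ j) =
      Polynomial.aeval (dZ η φ) (f.map (Polynomial.C (R := k))) * dX η φ ^ j := by
  rw [← xi_natCast, embD_ofPoly_mul_xi, gwaXi_natCast]

theorem embD_ofPoly_mul_y_pow (f : k[X]) (j : ℕ) :
    embD hη hφ (ofPoly 1 η φ f * y 1 η φ ^ j) =
      Polynomial.aeval (dZ η φ) (f.map (Polynomial.C (R := k))) * dY η φ ^ j := by
  rw [← xi_neg_natCast, embD_ofPoly_mul_xi, gwaXi_neg_natCast]

theorem coeffD_aeval_mul_x_pow (n : ℕ) (p : k[X][X]) (j : ℕ) :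
    coeffD hη hφ n (Polynomial.aeval (dZ η φ) p * dX η φ ^ j) =
      ofPoly 1 η φ (tauCoeff n p) * x 1 η φ ^ j := by
  rw [← xi_natCast, ← coeffD_aeval_mul_xi hη hφ, gwaXi_natCast]

theorem coeffD_aeval_mul_y_pow (n : ℕ) (p : k[X][X]) (j : ℕ) :
    coeffD hη hφ n (Polynomial.aeval (dZ η φ) p * dY η φ ^ j) =
      ofPoly 1 η φ (tauCoeff n p) * y 1 η φ ^ j := by
  rw [← xi_neg_natCast, ← coeffD_aeval_mul_xi hη hφ, gwaXi_neg_natCast]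

/-- Moving `x ^ q` past `g` shifts by `qη - qτ`; this is where `(-q) ^ n` comes from. -/
theorem structureMap_x_x (n q j : ℕ) (f g : k[X]) :
    structureMap hη hφ n (ofPoly 1 η φ f * x 1 η φ ^ q) (ofPoly 1 η φ g * x 1 η φ ^ j) =
      ofPoly 1 η φ (f * ((-(q : k)) ^ n •
        Polynomial.hasseDeriv n (Polynomial.taylor (q * η) g))) * x 1 η φ ^ (q + j) := by
  rw [structureMap_apply, embD_ofPoly_mul_x_pow, embD_ofPoly_mul_x_pow, mul_assoc,
    ← mul_assoc (dX η φ ^ q), (deformed_triple η φ).x_pow_mul_aeval, mul_assoc, ← pow_add,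
    ← mul_assoc, ← map_mul, coeffD_aeval_mul_x_pow, tauCoeff_map_mul, natCast_mul_tauShift,
    tauCoeff_taylor]

theorem structureMap_y_y (n q j : ℕ) (f g : k[X]) :
    structureMap hη hφ n (ofPoly 1 η φ f * y 1 η φ ^ q) (ofPoly 1 η φ g * y 1 η φ ^ j) =
      ofPoly 1 η φ (f * ((q : k) ^ n •
        Polynomial.hasseDeriv n (Polynomial.taylor (-(q * η)) g))) * y 1 η φ ^ (q + j) := by
  rw [structureMap_apply, embD_ofPoly_mul_y_pow, embD_ofPoly_mul_y_pow, mul_assoc,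
    ← mul_assoc (dY η φ ^ q), (deformed_triple η φ).y_pow_mul_aeval, mul_assoc, ← pow_add,
    ← mul_assoc, ← map_mul, coeffD_aeval_mul_y_pow, tauCoeff_map_mul, neg_natCast_mul_tauShift,
    tauCoeff_taylor]

/-- Here `x y = φ(z + η - τ)` depends on `τ` too, so the Hasse derivative acts on `g * φ`. -/
theorem structureMap_x_y (n j : ℕ) (f g : k[X]) :
    structureMap hη hφ n (ofPoly 1 η φ f * x 1 η φ) (ofPoly 1 η φ g * y 1 η φ ^ (j + 1)) =
      ofPoly 1 η φ (f * ((-1 : k) ^ n •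
        Polynomial.hasseDeriv n (Polynomial.taylor η (g * φ)))) * y 1 η φ ^ j := by
  have e1 := embD_ofPoly_mul_x_pow hη hφ f 1
  rw [pow_one, pow_one] at e1
  have e2 := natCast_mul_tauShift η 1
  rw [Nat.cast_one, Nat.cast_one, one_mul, one_mul] at e2
  rw [structureMap_apply, e1, embD_ofPoly_mul_y_pow, mul_assoc,
    ← mul_assoc (dX η φ), (deformed_triple η φ).x_mul_aeval, mul_assoc,
    (deformed_triple η φ).x_mul_y_pow_succ,
    ← mul_assoc, ← mul_assoc, ← map_mul, ← map_mul, coeffD_aeval_mul_y_pow, mul_assoc,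
    ← Polynomial.taylor_mul, ← Polynomial.map_mul, tauCoeff_map_mul, e2, tauCoeff_taylor]

/-- Since `y x = φ(z)` is free of `τ`, the factor `φ` stays outside the derivative, in contrast to
the case of `x y`. -/
theorem structureMap_y_x (n j : ℕ) (f g : k[X]) :
    structureMap hη hφ n (ofPoly 1 η φ f * y 1 η φ) (ofPoly 1 η φ g * x 1 η φ ^ (j + 1)) =
      ofPoly 1 η φ (f * (φ * Polynomial.hasseDeriv n (Polynomial.taylor (-η) g))) *
        x 1 η φ ^ j := by
  have e1 := embD_ofPoly_mul_y_pow hη hφ f 1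
  rw [pow_one, pow_one] at e1
  have e2 := neg_natCast_mul_tauShift η 1
  rw [Nat.cast_one, Nat.cast_one, one_mul, one_mul] at e2
  rw [structureMap_apply, e1, embD_ofPoly_mul_x_pow, mul_assoc,
    ← mul_assoc (dY η φ), (deformed_triple η φ).y_mul_aeval, mul_assoc,
    (deformed_triple η φ).y_mul_x_pow_succ,
    ← mul_assoc, ← mul_assoc, ← map_mul, ← map_mul, coeffD_aeval_mul_x_pow, mul_assoc,
    mul_comm _ (φ.map Polynomial.C), tauCoeff_map_mul, tauCoeff_map_mul, e2, tauCoeff_taylor,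
    one_pow, one_smul]

end GWA

/-! ### Comparison with `f(1)`, the conditions (a) and (b), the prescribed values and `Γ`. -/

namespace GWA

open BasisDeformation ShiftOperator

section Sums

variable {k : Type*} [Field k] {η : k} {φ : k[X]}

theorem z_pow_eq_ofPoly (p : ℕ) : z 1 η φ ^ p = ofPoly 1 η φ (Polynomial.X ^ p) := by
  simp [ofPoly]

theorem sigma_iterate (q : ℕ) (p : k[X]) :
    (sigma 1 η)^[q] p = Polynomial.taylor (q * η) p := by
  induction q generalizing p with
  | zero => simp
  | succ q ih =>
    rw [Function.iterate_succ_apply, ih, sigma_one_eq_taylor, Polynomial.taylor_taylor]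
    congr 2
    push_cast
    ring

theorem sigmaInv_iterate (q : ℕ) (p : k[X]) :
    (sigmaInv 1 η)^[q] p = Polynomial.taylor (-(q * η)) p := by
  induction q generalizing p with
  | zero => simp
  | succ q ih =>
    rw [Function.iterate_succ_apply, ih, sigmaInv_one_eq_taylor, Polynomial.taylor_taylor]
    congr 2
    push_cast
    ring

theorem derivative_taylor_X_pow (a : k) (i : ℕ) :
    Polynomial.derivative (Polynomial.taylor a (Polynomial.X ^ i)) =
      (i : k) • (Polynomial.taylor a Polynomial.X) ^ (i - 1) := by
  rw [Polynomial.taylor_pow, Polynomial.derivative_pow]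
  simp [Polynomial.smul_eq_C_mul]

/-- For `m = 1` the `i` summands attached to `z ^ i` all equal `σ(z) ^ (i - 1)`, which gives the
derivative. -/
theorem sigmaDeltaSigma_one (p : k[X]) :
    sigmaDeltaSigma (φ := φ) p 1 =
      ofPoly 1 η φ (Polynomial.derivative (Polynomial.taylor η p)) := by
  rw [Polynomial.taylor_apply, Polynomial.comp, Polynomial.eval₂_eq_sum, Polynomial.sum,
    Polynomial.derivative_sum, map_sum, sigmaDeltaSigma, Polynomial.sum]
  refine Finset.sum_congr rfl fun i _ => ?_
  have h := derivative_taylor_X_pow η i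
  rw [Polynomial.taylor_pow, Polynomial.taylor_X] at h
  rw [Polynomial.derivative_C_mul, h, ← Polynomial.smul_eq_C_mul, map_smul, map_smul, map_pow,
    sigma_one_eq_taylor, Polynomial.taylor_X]
  congr 1
  rw [Finset.sum_congr rfl (g := fun _ =>
    ofPoly 1 η φ (Polynomial.X + Polynomial.C η) ^ (i - 1))]
  · rw [Finset.sum_const, Finset.card_range, Nat.cast_smul_eq_nsmul]
  · intro j hj
    rw [Finset.mem_range] at hj
    rw [mul_one, ← pow_add]
    congr 1
    omega

/-- All `i * q` summands coincide: the powers of `u` combine to `u ^ q`, and moving `z ^ r` to its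
left completes `W ^ (i - 1 - r)` to `W ^ (i - 1)`. The factor `i` is absorbed in the derivative, `q`
remains. The general `a` serves both `x` (with `η`) and `y` (with `-η`). -/
theorem sum_pow_conj (u : GWA k 1 η φ) (a : k)
    (hu : ∀ (q : ℕ) (f : k[X]), u ^ q * ofPoly 1 η φ f =
      ofPoly 1 η φ (Polynomial.taylor (q * a) f) * u ^ q) (p q i : ℕ) (w : GWA k 1 η φ) :
    ∑ r ∈ Finset.range i, ∑ s ∈ Finset.range q,
        z 1 η φ ^ p * ofPoly 1 η φ (Polynomial.taylor (q * a) Polynomial.X) ^ (i - 1 - r) *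
          u ^ (q - 1 - s) * u * u ^ s * z 1 η φ ^ r * w =
      (q : k) • (ofPoly 1 η φ (Polynomial.X ^ p *
        Polynomial.derivative (Polynomial.taylor (q * a) (Polynomial.X ^ i))) * (u ^ q * w)) := by
  rw [derivative_taylor_X_pow]
  set W := Polynomial.taylor (q * a) (Polynomial.X : k[X]) with hW
  rw [Finset.sum_congr rfl (g := fun _ => (q : k) •
    (ofPoly 1 η φ (Polynomial.X ^ p * W ^ (i - 1)) * (u ^ q * w)))]
  · rw [Finset.sum_const, Finset.card_range, ← Nat.cast_smul_eq_nsmul k, mul_smul_comm, map_smul,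
      smul_mul_assoc, smul_comm]
  · intro r hr
    rw [Finset.mem_range] at hr
    rw [Finset.sum_congr rfl (g := fun _ =>
      ofPoly 1 η φ (Polynomial.X ^ p * W ^ (i - 1)) * (u ^ q * w))]
    · rw [Finset.sum_const, Finset.card_range, ← Nat.cast_smul_eq_nsmul k]
    · intro s hs
      rw [Finset.mem_range] at hs
      have e1 : u ^ (q - 1 - s) * u * u ^ s = u ^ q := by
        rw [← pow_succ, ← pow_add]
        congr 1
        omega
      have e2 : W ^ (i - 1) = W ^ (i - 1 - r) * W ^ r := by
        rw [← pow_add]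
        congr 1
        omega
      calc _ = z 1 η φ ^ p * ofPoly 1 η φ W ^ (i - 1 - r) *
            (u ^ (q - 1 - s) * u * u ^ s * z 1 η φ ^ r) * w := by simp only [mul_assoc]
        _ = _ := by
          rw [e1, z_pow_eq_ofPoly r, hu, Polynomial.taylor_pow, ← hW, z_pow_eq_ofPoly, e2]
          simp only [map_mul, map_pow, mul_assoc]

end Sums

variable {k : Type*} [Field k] [CharZero k] {η : k} (hη : η ≠ 0) {φ : k[X]} (hφ : φ ≠ 0)

/-- The cocycle identity is associativity at order one. -/
theorem structureMap_one_isHochschildCocycle : IsHochschildCocycle (structureMap hη hφ 1) := by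
  intro a b c
  have h := (deformation hη hφ).isFormalDeformation.sum_assoc 1 a b c
  simp only [deformation_F, Finset.Nat.antidiagonal_succ, Finset.Nat.antidiagonal_zero,
    Finset.map_singleton, Finset.sum_cons, Finset.sum_singleton, Function.Embedding.prodMap,
    Function.Embedding.coeFn_mk, Prod.map, structureMap_zero] at h
  simp only [Nat.succ_eq_add_one, Function.Embedding.refl_apply, structureMap_zero,
    zero_add] at h
  rw [hochschildB, sub_eq_zero, eq_comm]
  rw [← sub_eq_zero] at h ⊢
  rw [← h]
  abel

theorem conditionA_structureMap {n : ℕ} (hn : 1 ≤ n) : ConditionA (structureMap hη hφ n) :=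
  (deformation hη hφ).unital n hn

theorem structureMap_ofPoly_left {n : ℕ} (hn : 1 ≤ n) (f : k[X]) (v : GWA k 1 η φ) :
    structureMap hη hφ n (ofPoly 1 η φ f) v = 0 := by
  have h := map_ofPoly_mul (structureMap_z_mul hη hφ n) f 1 v
  rwa [mul_one, (conditionA_structureMap hη hφ hn v).2, mul_zero] at h

theorem structureMap_x_pow {n : ℕ} (hn : 1 ≤ n) (q j : ℕ) :
    structureMap hη hφ n (x 1 η φ ^ q) (x 1 η φ ^ j) = 0 := by
  have h := structureMap_x_x hη hφ n q j 1 1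
  rw [map_one, one_mul, one_mul] at h
  rw [h, Polynomial.taylor_one, Polynomial.hasseDeriv_C _ _ hn]
  simp

theorem structureMap_y_pow {n : ℕ} (hn : 1 ≤ n) (q j : ℕ) :
    structureMap hη hφ n (y 1 η φ ^ q) (y 1 η φ ^ j) = 0 := by
  have h := structureMap_y_y hη hφ n q j 1 1
  rw [map_one, one_mul, one_mul] at h
  rw [h, Polynomial.taylor_one, Polynomial.hasseDeriv_C _ _ hn]
  simp

theorem conditionB_structureMap {n : ℕ} (hn : 1 ≤ n) : ConditionB (structureMap hη hφ n) :=
  ⟨structureMap_z_mul hη hφ n, fun q j =>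
    ⟨structureMap_x_pow hη hφ hn q j, structureMap_y_pow hη hφ hn q j⟩⟩

theorem hasClassicalValues_structureMap {n : ℕ} (hn : 2 ≤ n) :
    HasClassicalValues n (structureMap hη hφ n) := by
  refine ⟨?_, ?_, ?_, ?_⟩
  · have h := structureMap_x_x hη hφ n 1 0 1 Polynomial.X
    -- A Hasse derivative of order at least two kills the linear polynomial `z + η`; for `n = 1` the
    -- value would be nonzero.
    rw [Polynomial.taylor_X, map_add, Polynomial.hasseDeriv_X _ (by omega),
      Polynomial.hasseDeriv_C _ _ (by omega)] at h
    simpa [ofPoly] using h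
  · have h := structureMap_y_y hη hφ n 1 0 1 Polynomial.X
    rw [Polynomial.taylor_X, map_add, Polynomial.hasseDeriv_X _ (by omega),
      Polynomial.hasseDeriv_C _ _ (by omega)] at h
    simpa [ofPoly] using h
  · have h := structureMap_x_y hη hφ n 0 1 1
    have e : Polynomial.derivative^[n] (sigma 1 η φ) =
        (n.factorial : k) • Polynomial.hasseDeriv n (Polynomial.taylor η φ) := by
      rw [← Polynomial.factorial_smul_hasseDeriv, sigma_one_eq_taylor, LinearMap.smul_apply,
        Nat.cast_smul_eq_nsmul]
    rw [e, map_smul, smul_smul, div_mul_cancel₀ _ (Nat.cast_ne_zero.2 n.factorial_ne_zero)]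
    rw [map_one, one_mul, one_mul, zero_add, pow_one, one_mul, one_mul, pow_zero, mul_one,
      map_smul] at h
    exact h
  · have h := structureMap_y_x hη hφ n 0 1 1
    rw [Polynomial.taylor_one, Polynomial.hasseDeriv_C _ _ (by omega)] at h
    simpa using h

theorem correspondsTo_structureMap :
    CorrespondsTo (structureMap hη hφ 1) (perCocycle 1) := by
  have t := triple η φ
  have hc1 : (perCocycle (1 : GWA k 1 η φ)).1 = x 1 η φ := by simp [perCocycle]
  have hc2 : (perCocycle (1 : GWA k 1 η φ)).2.1 = -y 1 η φ := by simp [perCocycle]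
  have hc3 : (perCocycle (1 : GWA k 1 η φ)).2.2.1 = 0 := by simp [perCocycle]
  have hc4 : (perCocycle (1 : GWA k 1 η φ)).2.2.2 =
      -ofPoly 1 η φ (Polynomial.derivative (Polynomial.taylor η φ)) := by
    simp [perCocycle, sigmaDeltaSigma_one]
  have hx : ∀ (q : ℕ) (f : k[X]), x 1 η φ ^ q * ofPoly 1 η φ f =
      ofPoly 1 η φ (Polynomial.taylor (q * η) f) * x 1 η φ ^ q := t.x_pow_mul_aeval
  have hy : ∀ (q : ℕ) (f : k[X]), y 1 η φ ^ q * ofPoly 1 η φ f =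
      ofPoly 1 η φ (Polynomial.taylor (q * (-η)) f) * y 1 η φ ^ q := by
    intro q f
    rw [mul_neg]
    exact t.y_pow_mul_aeval q f
  refine ⟨structureMap_one_isHochschildCocycle hη hφ, ?_, ?_, ?_, ?_, ?_⟩
  · intro p i q
    rw [z_pow_eq_ofPoly, structureMap_ofPoly_left hη hφ le_rfl]
  · intro p q i j
    simp only [hc1, one_smul, sigma_iterate]
    rw [sum_pow_conj _ η hx, z_pow_eq_ofPoly, z_pow_eq_ofPoly, structureMap_x_x,
      Polynomial.hasseDeriv_one', pow_one, mul_smul_comm, map_smul, smul_mul_assoc, neg_smul,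
      pow_add]
  · intro p q i j
    simp only [hc2, inv_one, one_smul, sigmaInv_iterate, mul_neg, neg_mul, Finset.sum_neg_distrib,
      neg_neg]
    have h := sum_pow_conj _ (-η) hy p q i (y 1 η φ ^ j)
    rw [mul_neg] at h
    rw [h, z_pow_eq_ofPoly, z_pow_eq_ofPoly, structureMap_y_y,
      Polynomial.hasseDeriv_one', pow_one, mul_smul_comm, map_smul, smul_mul_assoc, pow_add]
  · intro p i j
    have h := sum_pow_conj _ η hx p 1 i (y 1 η φ ^ (j + 1))
    simp only [Finset.range_one, Finset.sum_singleton, Nat.cast_one, one_mul, pow_zero, mul_one,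
      pow_one, Nat.sub_self, Nat.zero_sub, one_smul] at h
    have hxy : x 1 η φ * y 1 η φ ^ (j + 1) = ofPoly 1 η φ (Polynomial.taylor η φ) * y 1 η φ ^ j :=
      t.x_mul_y_pow_succ j
    simp only [hc1, hc4, sigma_one_eq_taylor]
    -- The product rule for the shift of `z ^ i * φ` yields the two nonzero components:
    -- differentiating `z ^ i` gives the sum over `r`, differentiating `φ` gives the fourth entry of
    -- `f(1)`.
    rw [h, hxy, z_pow_eq_ofPoly, z_pow_eq_ofPoly, structureMap_x_y, Polynomial.hasseDeriv_one',
      pow_one, Polynomial.taylor_mul, Polynomial.derivative_mul, neg_smul, one_smul]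
    simp only [map_mul, map_add, map_neg, mul_add, add_mul, mul_neg, neg_mul, mul_assoc, neg_add]
  · intro p i j
    have h := sum_pow_conj _ (-η) hy p 1 i (x 1 η φ ^ (j + 1))
    simp only [Finset.range_one, Finset.sum_singleton, Nat.cast_one, one_mul, pow_zero, mul_one,
      pow_one, Nat.sub_self, Nat.zero_sub, one_smul] at h
    have hyx : y 1 η φ * x 1 η φ ^ (j + 1) = ofPoly 1 η φ φ * x 1 η φ ^ j :=
      t.y_mul_x_pow_succ j
    simp only [hc2, hc3, sigmaInv_one_eq_taylor, mul_neg, neg_mul, Finset.sum_neg_distrib,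
      neg_neg, mul_zero, zero_mul, add_zero]
    rw [h, hyx, z_pow_eq_ofPoly, z_pow_eq_ofPoly, structureMap_y_x, Polynomial.hasseDeriv_one',
      mul_comm φ, ← mul_assoc (Polynomial.X ^ p), map_mul _ _ φ, mul_assoc]

/-- Taking `τ`-coefficients keeps the exponents of every monomial, so the filtration estimate in `H`
descends to each `F_n`. -/
theorem coeffD_mem_Gamma (n m : ℕ) {w : Deformed η φ}
    (hw : w ∈ gwaFiltration k[X] (dX η φ) (dY η φ) (dZ η φ) φ.natDegree m) :
    coeffD hη hφ n w ∈ Gamma 1 η φ m := by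
  induction hw using Submodule.closure_induction with
  | zero => rw [map_zero]; exact Submodule.zero_mem _
  | add u v _ _ hu hv => rw [map_add]; exact Submodule.add_mem _ hu hv
  | smul_mem r u hu =>
    obtain ⟨p, q, hpq, rfl⟩ := hu
    have h := coeffD_smul_monomial hη hφ n r (p, q)
    rw [gwaMonomial] at h
    rw [h]
    exact Submodule.smul_mem _ _ (Submodule.subset_span ⟨p, q, hpq, rfl⟩)

theorem preservesGamma_structureMap (n : ℕ) : PreservesGamma (structureMap hη hφ n) := by
  intro p p' q q'
  have h := (deformed_triple η φ).monomial_mul_monomial_mem_filtration (p, q) (p', q')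
  rw [Polynomial.natDegree_map] at h
  rw [← embD_monomial hη hφ, ← embD_monomial hη hφ] at h
  exact coeffD_mem_Gamma hη hφ n _ h

/-! ### The localization -/

/-- The inclusion `k[τ] → k((τ))`. -/
noncomputable def polyToLaurent (k : Type*) [Field k] : k[X] →+* k⸨X⸩ :=
  (algebraMap k⟦X⟧ k⸨X⸩).comp Polynomial.coeToPowerSeries.ringHom

theorem polyToLaurent_C {k : Type*} [Field k] (a : k) :
    polyToLaurent k (Polynomial.C a) = laurentConst k a := by
  simp [polyToLaurent, laurentConst, LaurentSeries.coe_algebraMap]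

theorem polyToLaurent_tauShift {k : Type*} [Field k] (η : k) :
    polyToLaurent k (tauShift η) = laurentConst k η - laurentTau k := by
  rw [tauShift, map_sub, polyToLaurent_C]
  congr 1
  simp [polyToLaurent, laurentTau, LaurentSeries.coe_algebraMap]

theorem laurentConst_sub_laurentTau_ne_zero {k : Type*} [Field k] (η : k) :
    laurentConst k η - laurentTau k ≠ 0 := by
  rw [← polyToLaurent_tauShift, polyToLaurent, RingHom.comp_apply]
  refine (map_ne_zero_iff _ (FaithfulSMul.algebraMap_injective k⟦X⟧ k⸨X⸩)).2 ?_
  exact (map_ne_zero_iff Polynomial.coeToPowerSeries.ringHom (Polynomial.coe_injective k)).2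
    (tauShift_ne_zero η)

theorem deformation_isLocallyFinite : (deformation hη hφ).IsLocallyFinite :=
  BasisDeformation.isLocallyFinite _ _ _ _

/-- The homomorphism from the deformed algebra over `k[τ]` to its localization. -/
noncomputable def toLocalized :
    Deformed η φ →+* (deformation hη hφ).Localized (deformation_isLocallyFinite hη hφ) :=
  (Algebra.TensorProduct.includeRight :
    (deformation hη hφ).tilde (deformation_isLocallyFinite hη hφ) →ₐ[k⟦X⟧] _).toRingHom.comp
    ((expandHom (monomialBasis hη hφ) (deformedBasis η hφ) (embD_one hη hφ)
      (structureMap_zero hη hφ)).codRestrict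
        ((deformation hη hφ).tilde (deformation_isLocallyFinite hη hφ))
        (expandHom_mem_tildeSubmodule _ _ _ _))

theorem toLocalized_embD (a : GWA k 1 η φ) :
    toLocalized hη hφ (embD hη hφ a) =
      1 ⊗ₜ[k⟦X⟧] (deformation hη hφ).ofA (deformation_isLocallyFinite hη hφ) a := by
  refine congrArg (fun s => (1 : k⸨X⸩) ⊗ₜ[k⟦X⟧] s) (Subtype.ext ?_)
  exact expandHom_emb _ _ _ _ a

/-- This semilinearity is what makes the images of the generators satisfy the relations with
parameter `η - τ` over `k((τ))`. -/
theorem toLocalized_algebraMap (r : k[X]) :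
    toLocalized hη hφ (algebraMap k[X] _ r) = algebraMap k⸨X⸩ _ (polyToLaurent k r) := by
  have h : toLocalized hη hφ (algebraMap k[X] _ r) = algebraMap k⟦X⟧ _ (r : k⟦X⟧) := by
    rw [← AlgHom.commutes (Algebra.TensorProduct.includeRight :
      (deformation hη hφ).tilde (deformation_isLocallyFinite hη hφ) →ₐ[k⟦X⟧]
        (deformation hη hφ).Localized (deformation_isLocallyFinite hη hφ))]
    refine congrArg (Algebra.TensorProduct.includeRight :
      (deformation hη hφ).tilde (deformation_isLocallyFinite hη hφ) →ₐ[k⟦X⟧]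
        (deformation hη hφ).Localized (deformation_isLocallyFinite hη hφ)) (Subtype.ext ?_)
    rw [Algebra.algebraMap_eq_smul_one]
    refine (expandHom_smul _ _ _ _ r 1).trans ?_
    rw [map_one]
    exact (Algebra.algebraMap_eq_smul_one (r : k⟦X⟧)).symm
  rw [h, IsScalarTower.algebraMap_apply k⟦X⟧ k⸨X⸩]
  rfl

/-- A spanning family with independent image is independent, so `f` matches a basis with a basis;
independence in the source need not be known beforehand. -/
theorem bijective_of_comp_basis {K V W ι : Type*} [Field K] [AddCommGroup V] [AddCommGroup W]
    [Module K V] [Module K W] (f : V →ₗ[K] W) {v : ι → V} (hv : Submodule.span K (Set.range v) = ⊤)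
    (b : Module.Basis ι K W) (hf : ∀ i, f (v i) = b i) : Function.Bijective f := by
  have hfv : f ∘ v = b := funext hf
  have hli : LinearIndependent K v := LinearIndependent.of_comp f (hfv ▸ b.linearIndependent)
  let bV := Module.Basis.mk hli hv.ge
  have h : f = (bV.equiv b (Equiv.refl ι)).toLinearMap := bV.ext fun i => by
    rw [LinearEquiv.coe_coe, Module.Basis.equiv_apply, Module.Basis.mk_apply, hf]
    rfl
  rw [h]
  exact (bV.equiv b (Equiv.refl ι)).bijective

theorem exists_localized_algEquiv :
    ∃ e : (deformation hη hφ).Localized (deformation_isLocallyFinite hη hφ) ≃ₐ[k⸨X⸩]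
        GWA k⸨X⸩ 1 (laurentConst k η - laurentTau k) (φ.map (laurentConst k)),
      e (1 ⊗ₜ[k⟦X⟧] (deformation hη hφ).ofA (deformation_isLocallyFinite hη hφ) (x 1 η φ)) =
        x _ _ _ ∧
      e (1 ⊗ₜ[k⟦X⟧] (deformation hη hφ).ofA (deformation_isLocallyFinite hη hφ) (y 1 η φ)) =
        y _ _ _ ∧
      e (1 ⊗ₜ[k⟦X⟧] (deformation hη hφ).ofA (deformation_isLocallyFinite hη hφ) (z 1 η φ)) =
        z _ _ _ := by
  have t := (deformed_triple η φ).map (polyToLaurent k) (toLocalized hη hφ)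
    (toLocalized_algebraMap hη hφ)
  have hc : (polyToLaurent k).comp Polynomial.C = laurentConst k :=
    RingHom.ext polyToLaurent_C
  rw [polyToLaurent_tauShift, Polynomial.map_map, hc] at t
  -- The universal property gives a map out of the classical algebra, so the required isomorphism is
  -- the inverse of `G`.
  obtain ⟨G, hx, hy, hz⟩ := exists_algHom _ _ t
  have hG : ∀ i, G.toLinearMap (gwaMonomial (x _ _ _) (y _ _ _) (z _ _ _) i) =
      Algebra.TensorProduct.basis k⸨X⸩ ((deformation hη hφ).tildeBasis
        (deformation_isLocallyFinite hη hφ) (monomialBasis hη hφ)) i := by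
    intro i
    rw [Algebra.TensorProduct.basis_apply, FormalDeformation.tildeBasis_apply,
      ← toLocalized_embD, monomialBasis_apply, embD_monomial,
      map_gwaMonomial _ _ _ (toLocalized hη hφ), ← hx, ← hy, ← hz]
    exact map_gwaMonomial _ _ _ G i
  have hbij : Function.Bijective G :=
    bijective_of_comp_basis G.toLinearMap (span_monomial_eq_top _ _) _ hG
  have hgen : ∀ (a : GWA k 1 η φ) (b : GWA k⸨X⸩ 1 (laurentConst k η - laurentTau k)
      (φ.map (laurentConst k))), G b = toLocalized hη hφ (embD hη hφ a) →
      (AlgEquiv.ofBijective G hbij).symm (1 ⊗ₜ[k⟦X⟧] (deformation hη hφ).ofA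
        (deformation_isLocallyFinite hη hφ) a) = b := by
    intro a b h
    rw [← toLocalized_embD, ← h]
    exact (AlgEquiv.ofBijective G hbij).symm_apply_apply b
  have ex : embD hη hφ (x 1 η φ) = dX η φ := by
    simpa [gwaMonomial, gwaXi] using embD_monomial hη hφ (0, 1)
  have ey : embD hη hφ (y 1 η φ) = dY η φ := by
    simpa [gwaMonomial, gwaXi] using embD_monomial hη hφ (0, -1)
  have ez : embD hη hφ (z 1 η φ) = dZ η φ := by
    simpa [gwaMonomial, gwaXi] using embD_monomial hη hφ (1, 0)
  exact ⟨(AlgEquiv.ofBijective G hbij).symm, hgen _ _ (by rw [hx, ex]), hgen _ _ (by rw [hy, ey]),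
    hgen _ _ (by rw [hz, ez])⟩

end GWA

/-! ### Assembly of the theorem. -/

theorem mainTheorem5 {k : Type*} [Field k] [CharZero k] (η : k) (hη : η ≠ 0)
    (φ : k[X]) (hφ : φ ≠ 0) :
    (∃! F₁ : Cochain2 k (GWA k 1 η φ), GWA.CorrespondsTo F₁ (GWA.perCocycle 1)) ∧
    ∀ F₁ : Cochain2 k (GWA k 1 η φ), GWA.CorrespondsTo F₁ (GWA.perCocycle 1) →
      ∃ D : FormalDeformation k (GWA k 1 η φ),
        (Integrates F₁ D.F ∧
          ∀ n, 2 ≤ n → ConditionA (D.F n) ∧ GWA.ConditionB (D.F n) ∧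
            GWA.HasClassicalValues n (D.F n)) ∧
        (∀ F : ℕ → Cochain2 k (GWA k 1 η φ), Integrates F₁ F →
          (∀ n, 2 ≤ n → ConditionA (F n) ∧ GWA.ConditionB (F n) ∧
            GWA.HasClassicalValues n (F n)) →
          F = D.F) ∧
        (∀ n, 1 ≤ n → GWA.PreservesGamma (D.F n)) ∧
        laurentConst k η - laurentTau k ≠ 0 ∧
        ∃ (h : D.IsLocallyFinite)
          (e : D.Localized h ≃ₐ[k⸨X⸩]
            GWA k⸨X⸩ 1 (laurentConst k η - laurentTau k) (φ.map (laurentConst k))),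
          e (1 ⊗ₜ[k⟦X⟧] D.ofA h (GWA.x 1 η φ)) = GWA.x _ _ _ ∧
          e (1 ⊗ₜ[k⟦X⟧] D.ofA h (GWA.y 1 η φ)) = GWA.y _ _ _ ∧
          e (1 ⊗ₜ[k⟦X⟧] D.ofA h (GWA.z 1 η φ)) = GWA.z _ _ _ := by
  have hcor := GWA.correspondsTo_structureMap hη hφ
  refine ⟨⟨_, hcor, fun F hF => hF.unique hcor⟩, fun F₁ hF₁ => ?_⟩
  -- An arbitrary `F₁` corresponding to `f(1)` is the first structure map, by uniqueness of the
  -- cocycle.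
  have hint : Integrates F₁ (GWA.deformation hη hφ).F :=
    ⟨hcor.unique hF₁, (GWA.deformation hη hφ).isFormalDeformation⟩
  have hval : ∀ n, 2 ≤ n → ConditionA ((GWA.deformation hη hφ).F n) ∧
      GWA.ConditionB ((GWA.deformation hη hφ).F n) ∧
      GWA.HasClassicalValues n ((GWA.deformation hη hφ).F n) := fun n hn =>
    ⟨GWA.conditionA_structureMap hη hφ (by omega), GWA.conditionB_structureMap hη hφ (by omega),
      GWA.hasClassicalValues_structureMap hη hφ hn⟩
  exact ⟨GWA.deformation hη hφ, ⟨hint, hval⟩,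
    fun F hF h => GWA.integrating_family_unique hF hint h hval,
    fun n _ => GWA.preservesGamma_structureMap hη hφ n,
    GWA.laurentConst_sub_laurentTau_ne_zero η,
    GWA.deformation_isLocallyFinite hη hφ, GWA.exists_localized_algEquiv hη hφ⟩
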